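/- Let $n\ge 5$ and let $s\neq t$ be integers with $1\le s,t\le \lfloor n/2\rfloor$. Let $C_n(s,t)$ be the circulant graph with vertex set $\mathbb{Z}/n$ in which $x$ and $y$ are adjacent if and only if $x-y\equiv \pm s$ or $x-y\equiv\pm t \pmod n$. Let $\mathcal{N}(C_n(s,t))$ be its neighborhood complex, i.e. the simplicial complex whose simplices are the nonempty sets of vertices of $C_n(s,t)$ that have a common neighbor. Assume that $n\notin\{2s,\,2t,\,2(s+t)\}$ and that $3s=t$ or $3t=s$. Then each connected component of (the geometric realization of) $\mathcal{N}(C_n(s,t))$ is homotopy equivalent to (A) the sphere $S^3$, if $3s=t$ and $n=10s$ (or $3t=s$ and $n=10t$); (B) the wedge $S^2\vee S^2$, if $3s=t$ and $n=12s$ (or $3t=s$ and $n=12t$); (C) a wedge sum of finitely many, and at least one, circles, if $3s=t$ and $n\notin\{8s,10s,12s\}$ (or $3t=s$ and $n\notin\{8t,10t,12t\}$). -/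

import Mathlib

open scoped ContinuousMap

noncomputable section

/-- The set `I` of admissible pairs: `s, t ∈ {1, …, ⌊n/2⌋}` with `s ≠ t`
(the condition is symmetric in `s` and `t`, so it is one on the unordered pair `{s, t}`). -/
def InI (n s t : ℕ) : Prop :=
  s ∈ Set.Icc 1 (n / 2) ∧ t ∈ Set.Icc 1 (n / 2) ∧ s ≠ t

/-- The class `I₁`: pairs of `I` with `n ∈ {2s, 2t, 2(s+t)}`. -/
def InI1 (n s t : ℕ) : Prop :=
  InI n s t ∧ (n = 2 * s ∨ n = 2 * t ∨ n = 2 * (s + t))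

/-- The class `I₂`: pairs of `I \ I₁` with `3s = t` or `3t = s`. -/
def InI2 (n s t : ℕ) : Prop :=
  InI n s t ∧ ¬ InI1 n s t ∧ (3 * s = t ∨ 3 * t = s)

/-- The circulant graph `C_n(s,t)`, on the residue classes modulo `n`:
distinct `x`, `y` are adjacent iff `x - y` or `y - x` is `s` or `t` modulo `n`. -/
def circulant (n s t : ℕ) : SimpleGraph (ZMod n) :=
  SimpleGraph.circulantGraph ({(s : ZMod n), (t : ZMod n)} : Set (ZMod n))

/-- The neighborhood complex of a graph: its simplices are the nonempty finite sets of vertices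
that have a common neighbor (so its vertices are the non-isolated vertices of `G`). -/
def neighborhoodComplex {V : Type*} (G : SimpleGraph V) : PreAbstractSimplicialComplex V where
  faces := {σ | σ.Nonempty ∧ ∃ w, ∀ v ∈ σ, G.Adj v w}
  isRelLowerSet_faces := by
    rintro σ ⟨hne, w, hw⟩
    exact ⟨hne, fun τ hτ hτne => ⟨hτne, w, fun v hv => hw v (hτ hv)⟩⟩

/-- The geometric realization of a simplicial complex on a finite vertex set `V`: the union in
`V → ℝ` of the simplices spanned by the faces (points given by their barycentric coordinates),
with the subspace topology. -/
def geomRealization {V : Type*} (K : PreAbstractSimplicialComplex V) : Set (V → ℝ) :=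
  {x | ∃ σ ∈ K.faces, (∀ v, 0 ≤ x v) ∧ (∀ v, v ∉ σ → x v = 0) ∧ ∑ v ∈ σ, x v = 1}

/-- The relation on a disjoint union of pointed spaces that identifies all base points. -/
def wedgeRel {ι : Type*} {X : ι → Type*} (p : ∀ i, X i) (a b : Σ i, X i) : Prop :=
  ∃ i j, a = ⟨i, p i⟩ ∧ b = ⟨j, p j⟩

/-- The wedge sum of a family of pointed spaces: the disjoint union with all base points
identified. -/
def Wedge {ι : Type*} {X : ι → Type*} (p : ∀ i, X i) : Type _ :=
  Quot (wedgeRel p)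

/-- The quotient topology on the wedge sum. -/
instance {ι : Type*} {X : ι → Type*} [∀ i, TopologicalSpace (X i)] (p : ∀ i, X i) :
    TopologicalSpace (Wedge p) :=
  inferInstanceAs (TopologicalSpace (Quot (wedgeRel p)))

/-- The standard sphere `S^m`: the unit sphere of `ℝ^(m+1)`. -/
abbrev Sph (m : ℕ) : Type :=
  Metric.sphere (0 : EuclideanSpace ℝ (Fin (m + 1))) 1

/-- The base point `(1, 0, …, 0)` of `S^m`. -/
def Sph.base (m : ℕ) : Sph m :=
  ⟨EuclideanSpace.single 0 1, by simp⟩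

/-- The wedge sum of `k` copies of `S^m`. -/
abbrev SphWedge (k m : ℕ) : Type :=
  Wedge (fun _ : Fin k => Sph.base m)

end

/-!
By the symmetry in `s` and `t` let `t = 3 s`, so that `6 s < n` and `n ≠ 8 s`. The neighbors of `w`
are `w - 3 s + k * 2 s` for `k = 0, 1, 2, 3`. Hence every simplex lies in one coset of the subgroup
generated by `2 s`. If `m` is the order of `2 s` modulo `n`, this coset is a copy of `ZMod m` in which
the facets are all windows of four cyclically consecutive elements. The realization of this window
complex is connected, so it is homeomorphic to every component
(`exists_windowComplex_homeomorph`). Moreover `5 ≤ m`, with `m = 5` exactly for `n = 10 s` and `m = 6`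
exactly for `n = 12 s`. It remains to find the homotopy type of the window complex.

* `m = 5`: the complex is the boundary of a 4-simplex, a 3-sphere.
* `7 ≤ m`: place the vertices at the `m`-th roots of unity. Four consecutive ones lie in an open half
  plane, so barycentric combination is a map to `ℂ \ {0}`. A partition of unity by tent functions
  around the roots gives a map back. Both compositions are homotopic to the identity by straight
  lines, because a point in the cone of a window only meets the tents of this window. So there is
  one circle.
* `m = 6`: the combination of the roots can vanish, but only at the midpoint of the edge `{i, i + 3}`
  in the window at `i`. There are three such edges. Recording the smaller of the two weights of each
  antipodal pair as a second coordinate, on a tripod with one leg for each pair, gives in the same way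
  a homotopy equivalence with `ℂ` times a tripod, without the origin. This space is three disks glued
  along a circle up to homotopy, which is `ℝ³` without two points, or two tangent spheres.
-/

/-! ### Straight-line homotopies -/

/-- Two maps into a subset `S` of a real topological vector space are homotopic as soon as the
segments joining their values stay in `S`. -/
theorem homotopic_of_segment_subset {X E : Type*} [TopologicalSpace X] [AddCommGroup E]
    [TopologicalSpace E] [IsTopologicalAddGroup E] [Module ℝ E] [ContinuousSMul ℝ E] {S : Set E}
    (f g : C(X, S)) (h : ∀ x, segment ℝ (f x : E) (g x) ⊆ S) : f.Homotopic g := by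
  refine ⟨⟨⟨fun p => ⟨AffineMap.lineMap (f p.2 : E) (g p.2 : E) (p.1 : ℝ), h p.2 ?_⟩, ?_⟩, ?_, ?_⟩⟩
  · rw [segment_eq_image_lineMap]
    exact ⟨p.1, p.1.2, rfl⟩
  · refine Continuous.subtype_mk ?_ _
    simp only [AffineMap.lineMap_apply, vsub_eq_sub, vadd_eq_add]
    fun_prop
  · intro x; ext; simp
  · intro x; ext; simp

theorem nonempty_homotopyEquiv_of_segment_subset {E F : Type*}
    [AddCommGroup E] [TopologicalSpace E] [IsTopologicalAddGroup E] [Module ℝ E]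
    [ContinuousSMul ℝ E] [AddCommGroup F] [TopologicalSpace F] [IsTopologicalAddGroup F]
    [Module ℝ F] [ContinuousSMul ℝ F] {A : Set E} {B : Set F} (f : C(A, B)) (g : C(B, A))
    (hgf : ∀ x : A, segment ℝ (g (f x) : E) x ⊆ A)
    (hfg : ∀ y : B, segment ℝ (f (g y) : F) y ⊆ B) : Nonempty (A ≃ₕ B) :=
  ⟨⟨f, g, homotopic_of_segment_subset _ _ hgf, homotopic_of_segment_subset _ _ hfg⟩⟩

/-! ### Models of a wedge of two 2-spheres -/

/-- The union of two unit spheres in `ℂ × ℝ = ℝ³` with centers `(0, 1)` and `(0, -1)`, which touch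
at the origin. -/
def tangentSpheres : Set (ℂ × ℝ) := {p | ‖p.1‖ ^ 2 + (|p.2| - 1) ^ 2 = 1}

/-- The space `ℂ × ℝ = ℝ³` without the two points `(0, 1)` and `(0, -1)`. -/
def twicePunctured : Set (ℂ × ℝ) := {p | p.1 = 0 → |p.2| ≠ 1}

/-- The product of `ℂ` with an infinite tripod, without the origin. The tripod is
`{(y, w) | 0 ≤ w, y * w = 0}`: its legs are `y ≥ 0`, `y ≤ 0` and `w ≥ 0`. -/
def puncturedTripod : Set (ℂ × ℝ × ℝ) := {q | 0 ≤ q.2.2 ∧ q.2.1 * q.2.2 = 0 ∧ q ≠ 0}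

theorem nonempty_sphWedge_two_two_homeomorph :
    Nonempty (SphWedge 2 2 ≃ₜ tangentSpheres) := by
  have hS : ∀ v : Sph 2, (v : EuclideanSpace ℝ (Fin 3)) 0 ^ 2
      + (v : EuclideanSpace ℝ (Fin 3)) 1 ^ 2 + (v : EuclideanSpace ℝ (Fin 3)) 2 ^ 2 = 1 := by
    intro v
    have h := v.2
    rw [mem_sphere_zero_iff_norm, EuclideanSpace.norm_eq, Real.sqrt_eq_one] at h
    simpa [Fin.sum_univ_three] using h
  have hn : ∀ a b : ℝ, ‖(⟨a, b⟩ : ℂ)‖ ^ 2 = a ^ 2 + b ^ 2 := by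
    intro a b
    rw [Complex.sq_norm, Complex.normSq_mk]; ring
  have hle : ∀ v : Sph 2, 0 ≤ 1 - (v : EuclideanSpace ℝ (Fin 3)) 0 := by
    intro v; nlinarith [hS v]
  let sg : Fin 2 → ℝ := ![1, -1]
  have hsg : ∀ i, |sg i| = 1 := by intro i; fin_cases i <;> simp [sg]
  let F : (Σ _ : Fin 2, Sph 2) → tangentSpheres := fun a =>
    ⟨(⟨(a.2 : EuclideanSpace ℝ (Fin 3)) 1, (a.2 : EuclideanSpace ℝ (Fin 3)) 2⟩,
      sg a.1 * (1 - (a.2 : EuclideanSpace ℝ (Fin 3)) 0)), by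
      have := hS a.2
      simp only [tangentSpheres, Set.mem_ofPred_eq, hn, abs_mul, hsg, abs_of_nonneg (hle a.2)]
      linarith⟩
  have hFc : Continuous F := by
    refine continuous_sigma fun i => Continuous.subtype_mk (Continuous.prodMk ?_ ?_) _
    · have : Continuous fun v : Sph 2 => Complex.equivRealProdCLM.symm
          ((v : EuclideanSpace ℝ (Fin 3)) 1, (v : EuclideanSpace ℝ (Fin 3)) 2) := by fun_prop
      exact this
    · fun_prop
  let G : tangentSpheres → (Σ _ : Fin 2, Sph 2) := fun p =>
    ⟨if 0 ≤ p.1.2 then 0 else 1, ⟨!₂[1 - |p.1.2|, p.1.1.re, p.1.1.im], by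
      have h := p.2
      simp only [tangentSpheres, Set.mem_ofPred_eq] at h
      rw [mem_sphere_zero_iff_norm, EuclideanSpace.norm_eq, Real.sqrt_eq_one]
      rw [Complex.sq_norm, Complex.normSq_apply] at h
      simp [Fin.sum_univ_three]
      linarith⟩⟩
  have hlift : ∀ a b, wedgeRel (fun _ : Fin 2 => Sph.base 2) a b → F a = F b := by
    rintro a b ⟨i, j, rfl, rfl⟩
    apply Subtype.ext
    simp [F, Sph.base]
  have hGF : ∀ a, (Quot.mk _ (G (F a)) : SphWedge 2 2) = Quot.mk _ a := by
    rintro ⟨i, v⟩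
    have hv : (⟨!₂[1 - |sg i * (1 - (v : EuclideanSpace ℝ (Fin 3)) 0)|,
        (v : EuclideanSpace ℝ (Fin 3)) 1, (v : EuclideanSpace ℝ (Fin 3)) 2], by
          simpa [F, G] using (G (F ⟨i, v⟩)).2.2⟩ : Sph 2) = v := by
      apply Subtype.ext
      ext k
      have hk : |sg i * (1 - (v : EuclideanSpace ℝ (Fin 3)) 0)|
          = 1 - (v : EuclideanSpace ℝ (Fin 3)) 0 := by
        rw [abs_mul, hsg, one_mul, abs_of_nonneg (hle v)]
      fin_cases k <;> simp [hk]
    by_cases h0 : (v : EuclideanSpace ℝ (Fin 3)) 0 = 1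
    · have hb : v = Sph.base 2 := by
        have := hS v
        rw [h0] at this
        have h1 : (v : EuclideanSpace ℝ (Fin 3)) 1 = 0 := by nlinarith
        have h2 : (v : EuclideanSpace ℝ (Fin 3)) 2 = 0 := by nlinarith
        apply Subtype.ext
        ext k
        fin_cases k <;> simp [Sph.base, h0, h1, h2]
      apply Quot.sound
      refine ⟨_, i, Sigma.ext rfl (heq_of_eq (hv.trans hb)), Sigma.ext rfl (heq_of_eq hb)⟩
    · have hpos : 0 < 1 - (v : EuclideanSpace ℝ (Fin 3)) 0 :=
        lt_of_le_of_ne (hle v) fun h => h0 (by linarith)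
      have hi : (if 0 ≤ sg i * (1 - (v : EuclideanSpace ℝ (Fin 3)) 0) then (0 : Fin 2) else 1)
          = i := by
        fin_cases i
        · simp [sg, hpos.le]
        · simp only [sg]
          rw [if_neg (by simp; linarith)]
          rfl
      exact congrArg _ (Sigma.ext hi (heq_of_eq hv))
  have hFG : ∀ p, F (G p) = p := by
    intro p
    apply Subtype.ext
    refine Prod.ext (Complex.ext (by simp [F, G]) (by simp [F, G])) ?_
    by_cases h : 0 ≤ p.1.2
    · simp [F, G, sg, h, abs_of_nonneg h]
    · simp [F, G, sg, h, abs_of_neg (not_le.mp h)]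
  let e : SphWedge 2 2 ≃ tangentSpheres :=
    { toFun := Quot.lift F hlift
      invFun := fun p => Quot.mk _ (G p)
      left_inv := by rintro ⟨a⟩; exact hGF a
      right_inv := hFG }
  have : CompactSpace (SphWedge 2 2) := inferInstanceAs (CompactSpace (Quot _))
  exact ⟨Continuous.homeoOfEquivCompactToT2 (f := e) (continuous_quot_lift hlift hFc)⟩

/-- The point of the two tangent spheres that results from `(z, y)` by scaling `z` by `a` and then
projecting radially from the center `(0, ±1)` in the same half space. For `y = 0` this is continuous
only if `a • z = 0`, where both projections give the contact point. -/
noncomputable def radialProj (a : ℝ) (z : ℂ) (y : ℝ) : ℂ × ℝ :=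
  (((a / √(‖a • z‖ ^ 2 + (|y| - 1) ^ 2) : ℝ) : ℂ) * z,
    if 0 ≤ y then 1 + (|y| - 1) / √(‖a • z‖ ^ 2 + (|y| - 1) ^ 2)
    else -(1 + (|y| - 1) / √(‖a • z‖ ^ 2 + (|y| - 1) ^ 2)))

theorem abs_radialProj_snd {a : ℝ} {z : ℂ} {y : ℝ} :
    |(radialProj a z y).2| = 1 + (|y| - 1) / √(‖a • z‖ ^ 2 + (|y| - 1) ^ 2) := by
  have h0 : 0 ≤ 1 + (|y| - 1) / √(‖a • z‖ ^ 2 + (|y| - 1) ^ 2) := by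
    have : |(|y| - 1) / √(‖a • z‖ ^ 2 + (|y| - 1) ^ 2)| ≤ 1 := by
      rw [abs_div, abs_of_nonneg (Real.sqrt_nonneg _)]
      refine div_le_one_of_le₀ ?_ (Real.sqrt_nonneg _)
      refine Real.le_sqrt_of_sq_le ?_
      rw [sq_abs]
      nlinarith [sq_nonneg ‖a • z‖]
    linarith [neg_le_of_abs_le this]
  simp only [radialProj]
  split_ifs
  · exact abs_of_nonneg h0
  · rw [abs_neg, abs_of_nonneg h0]

theorem radialProj_mem {a : ℝ} {z : ℂ} {y : ℝ} (h : ‖a • z‖ ^ 2 + (|y| - 1) ^ 2 ≠ 0) :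
    radialProj a z y ∈ tangentSpheres := by
  have hD : 0 ≤ ‖a • z‖ ^ 2 + (|y| - 1) ^ 2 := by positivity
  have hs : √(‖a • z‖ ^ 2 + (|y| - 1) ^ 2) ^ 2 = ‖a • z‖ ^ 2 + (|y| - 1) ^ 2 := Real.sq_sqrt hD
  have hn : ‖a • z‖ ^ 2 = a ^ 2 * ‖z‖ ^ 2 := by
    rw [norm_smul, mul_pow, Real.norm_eq_abs, sq_abs]
  simp only [tangentSpheres, Set.mem_ofPred_eq, abs_radialProj_snd]
  simp only [radialProj, norm_mul, Complex.norm_real, mul_pow, Real.norm_eq_abs, sq_abs, div_pow,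
    add_sub_cancel_left, hs]
  field_simp
  rw [hn]

theorem continuous_radialProj {X : Type*} [TopologicalSpace X] {a : X → ℝ} {z : X → ℂ} {y : X → ℝ}
    (ha : Continuous a) (hz : Continuous z) (hy : Continuous y)
    (hD : ∀ x, ‖a x • z x‖ ^ 2 + (|y x| - 1) ^ 2 ≠ 0) (h0 : ∀ x, y x = 0 → a x • z x = 0) :
    Continuous fun x => radialProj (a x) (z x) (y x) := by
  have hs : ∀ x, √(‖a x • z x‖ ^ 2 + (|y x| - 1) ^ 2) ≠ 0 := fun x =>
    Real.sqrt_ne_zero'.mpr (lt_of_le_of_ne (by positivity) (hD x).symm)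
  have hc : Continuous fun x => √(‖a x • z x‖ ^ 2 + (|y x| - 1) ^ 2) := by fun_prop
  refine Continuous.prodMk ((Complex.continuous_ofReal.comp (ha.div hc hs)).mul hz) ?_
  have h1 : Continuous fun x => 1 + (|y x| - 1) / √(‖a x • z x‖ ^ 2 + (|y x| - 1) ^ 2) :=
    continuous_const.add (Continuous.div (by fun_prop) hc hs)
  refine Continuous.if_le h1 h1.neg continuous_const hy fun x hx => ?_
  rw [h0 x hx.symm, ← hx]
  simp

/-- The twice punctured space retracts onto the two tangent spheres: scale the first coordinate by
`min 1 |y|`, which closes the plane `y = 0` to a point, then project radially from the puncture in the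
same half space. -/
theorem nonempty_twicePunctured_homotopyEquiv_tangentSpheres :
    Nonempty (twicePunctured ≃ₕ tangentSpheres) := by
  -- the scaling factor `1 - τ + τ * min 1 |y|` deforms `1` into `min 1 |y|`; on the tangent spheres
  -- the projection is defined for all `τ ∈ [0, 1]`, and it is the identity for `τ = 0`
  have hD : ∀ τ : ℝ, ∀ p : ℂ × ℝ, p ∈ twicePunctured →
      ‖(1 - τ + τ * min 1 |p.2|) • p.1‖ ^ 2 + (|p.2| - 1) ^ 2 ≠ 0 := by
    intro τ p hp h
    have h2 := ((add_eq_zero_iff_of_nonneg (sq_nonneg _) (sq_nonneg _)).1 h).2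
    have h1 : |p.2| = 1 := sub_eq_zero.mp (pow_eq_zero_iff two_ne_zero |>.mp h2)
    rw [h1] at h
    simp at h
    exact hp h h1
  have hsub : tangentSpheres ⊆ twicePunctured := by
    intro p hp hz hy
    simp [tangentSpheres, hz, hy] at hp
  have h0 : ∀ p ∈ tangentSpheres, p.2 = 0 → p.1 = 0 := by
    intro p hp h
    simpa [tangentSpheres, h] using hp
  let r : C(twicePunctured, tangentSpheres) :=
    ⟨fun p => ⟨radialProj (1 - 1 + 1 * min 1 |p.1.2|) p.1.1 p.1.2, radialProj_mem (hD 1 _ p.2)⟩,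
      Continuous.subtype_mk (continuous_radialProj (by fun_prop) (by fun_prop) (by fun_prop)
        (fun p => hD 1 _ p.2) (fun p hp => by simp [hp])) _⟩
  let ι : C(tangentSpheres, twicePunctured) := ⟨fun p => ⟨p.1, hsub p.2⟩, by fun_prop⟩
  refine ⟨⟨r, ι, ?_, ?_⟩⟩
  · refine homotopic_of_segment_subset _ _ ?_
    rintro ⟨⟨z, y⟩, hp⟩ _ ⟨a, b, ha, hb, hab, rfl⟩ hz hy
    have hd := Real.sqrt_ne_zero'.mpr (lt_of_le_of_ne (by positivity) (hD 1 _ hp).symm)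
    simp only [r, ι, ContinuousMap.comp_apply, ContinuousMap.coe_mk, ContinuousMap.id_apply,
      Prod.fst_add, Prod.snd_add, Prod.smul_fst, Prod.smul_snd, smul_eq_mul] at hz hy
    simp only [radialProj] at hz hy
    simp only at hd
    set d := √(‖(1 - 1 + 1 * min 1 |y|) • z‖ ^ 2 + (|y| - 1) ^ 2) with hdd
    have hd0 : 0 < d := lt_of_le_of_ne (Real.sqrt_nonneg _) hd.symm
    have hq : 0 ≤ 1 + (|y| - 1) / d := by
      rw [← abs_radialProj_snd]; exact abs_nonneg _
    have hy' : a * (1 + (|y| - 1) / d) + b * |y| = 1 := by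
      have hnn : 0 ≤ a * (1 + (|y| - 1) / d) + b * |y| := by positivity
      refine Eq.trans ?_ hy
      split_ifs with h
      · rw [abs_of_nonneg h] at hnn ⊢
        rw [abs_of_nonneg hnn]
      · rw [abs_of_neg (not_le.mp h)] at hnn ⊢
        rw [← abs_neg, show -(a * -(1 + (-y - 1) / d) + b * y)
          = a * (1 + (-y - 1) / d) + b * -y by ring, abs_of_nonneg hnn]
    have hc : 0 < a / d + b := by
      rcases ha.eq_or_lt with h | h
      · rw [← h] at hab ⊢; simp at hab ⊢; linarith
      · positivity
    have hy1 : |y| = 1 := by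
      have : (a / d + b) * (|y| - 1) = 0 := by
        have : (a / d + b) * (|y| - 1) = a * (1 + (|y| - 1) / d) + b * |y| - (a + b) := by ring
        rw [this, hy', hab, sub_self]
      rcases mul_eq_zero.mp this with h | h
      · exact absurd h hc.ne'
      · linarith
    refine hp ?_ hy1
    rw [hy1] at hz
    have : (((a / d + b : ℝ)) : ℂ) * z = 0 := by
      rw [← hz]; simp; ring
    exact (mul_eq_zero.mp this).resolve_left (by exact_mod_cast hc.ne')
  · refine ContinuousMap.Homotopic.symm ⟨⟨⟨fun q => ⟨radialProj (1 - (q.1 : ℝ) + (q.1 : ℝ) *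
      min 1 |q.2.1.2|) q.2.1.1 q.2.1.2, radialProj_mem (hD _ _ (hsub q.2.2))⟩, ?_⟩, ?_, ?_⟩⟩
    · exact Continuous.subtype_mk (continuous_radialProj (by fun_prop) (by fun_prop) (by fun_prop)
        (fun q => hD _ _ (hsub q.2.2)) (fun q hq => by simp [h0 _ q.2.2 hq])) _
    · rintro ⟨⟨z, y⟩, hp⟩
      apply Subtype.ext
      have h1 : √(‖z‖ ^ 2 + (|y| - 1) ^ 2) = 1 := by
        rw [show ‖z‖ ^ 2 + (|y| - 1) ^ 2 = 1 from hp, Real.sqrt_one]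
      simp [radialProj, h1]
      split_ifs with h
      · exact abs_of_nonneg h
      · rw [abs_of_neg (not_le.mp h), neg_neg]
    · intro p
      apply Subtype.ext
      simp [r, ι]

/-- Up to scaling, the punctured tripod space consists of three disks glued along their boundary
circle. In `ℝ³` these become the two halves of a sphere around both punctures, and the disk that
separates the punctures. The map back folds the slab `|y| ≤ 1` onto the third disk. -/
theorem nonempty_puncturedTripod_homotopyEquiv_twicePunctured :
    Nonempty (puncturedTripod ≃ₕ twicePunctured) := by
  have hpos : ∀ q ∈ puncturedTripod, 0 < ‖q.1‖ + |q.2.1| + q.2.2 := by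
    rintro ⟨z, y, w⟩ ⟨hw, -, h0⟩
    refine lt_of_le_of_ne (by simp only at hw ⊢; positivity) fun h => h0 ?_
    simp only at hw h
    have hz := norm_nonneg z
    have hy := abs_nonneg y
    have h1 : z = 0 := norm_eq_zero.mp (by linarith)
    have h2 : y = 0 := abs_eq_zero.mp (by linarith)
    have h3 : w = 0 := by linarith
    simp [h1, h2, h3]
  -- after normalizing to length `3`, the legs `y` end at `(0, ±3)`, beyond the punctures `(0, ±1)`
  let sc : puncturedTripod → ℝ := fun q => 3 / (‖q.1.1‖ + |q.1.2.1| + q.1.2.2)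
  have hsc : ∀ q, 0 < sc q := fun q => div_pos (by norm_num) (hpos _ q.2)
  have hscc : Continuous sc := Continuous.div (by fun_prop) (by fun_prop) fun q => (hpos _ q.2).ne'
  have hnorm : ∀ q, ‖sc q • q.1.1‖ + |sc q * q.1.2.1| + sc q * q.1.2.2 = 3 := by
    intro q
    rw [norm_smul, abs_mul, Real.norm_eq_abs, abs_of_pos (hsc q)]
    have := (hpos _ q.2).ne'
    simp only [sc]
    field_simp
  let cl : ℝ → ℝ → ℝ := fun a y => max (-a) (min a y)
  have hcl : ∀ a y : ℝ, 0 ≤ a → |y| ≤ a → cl a y = y := by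
    intro a y ha h
    have := abs_le.mp h
    simp only [cl]
    rw [min_eq_right this.2, max_eq_right this.1]
  have hcl' : ∀ a y : ℝ, 0 ≤ a → cl a y = y → |y| ≤ a := by
    intro a y ha h
    rw [← h]
    exact abs_le.mpr ⟨le_max_left _ _, max_le (by linarith) (min_le_left _ _)⟩
  -- the legs `y` are shortened by `a`, and what is cut off is bent into the leg `w`
  let bend : ℝ → ℂ × ℝ × ℝ → ℂ × ℝ × ℝ := fun a q =>
    (q.1, q.2.1 - cl a q.2.1, (1 - a) * q.2.2 + max 0 (a - |q.2.1|))
  have hbend : ∀ a : ℝ, 0 ≤ a → a ≤ 1 → ∀ q : puncturedTripod,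
      bend a (sc q • q.1) ∈ puncturedTripod := by
    intro a ha ha1 q
    have hN := hnorm q
    obtain ⟨hw, hyw, -⟩ := q.2
    have hw' : 0 ≤ sc q * q.1.2.2 := mul_nonneg (hsc q).le hw
    have hyw' : (sc q * q.1.2.1) * (sc q * q.1.2.2) = 0 := by
      rw [show (sc q * q.1.2.1) * (sc q * q.1.2.2) = sc q ^ 2 * (q.1.2.1 * q.1.2.2) by ring,
        hyw, mul_zero]
    simp only [bend, Prod.smul_fst, Prod.smul_snd, smul_eq_mul]
    generalize sc q * q.1.2.1 = y at *
    generalize sc q * q.1.2.2 = w at *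
    generalize sc q • q.1.1 = z at *
    refine ⟨add_nonneg (mul_nonneg (by linarith) hw') (le_max_left _ _), ?_, ?_⟩
    · simp only
      rcases le_or_gt |y| a with h | h
      · rw [hcl a y ha h, sub_self, zero_mul]
      · have hy : y ≠ 0 := by rintro rfl; simp at h; linarith
        rw [(mul_eq_zero.mp hyw').resolve_left hy, max_eq_left (by linarith)]
        simp
    · intro h
      simp only [Prod.mk_eq_zero] at h
      obtain ⟨h1, h2, h3⟩ := h
      have h4 := hcl' a y ha (by linarith)
      have h5 : a - |y| ≤ max 0 (a - |y|) := le_max_right _ _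
      rcases mul_eq_zero.mp hyw' with h | h
      · simp [h1, h] at hN h5 h3
        rw [hN, max_eq_right ha] at h3
        linarith
      · simp [h1, h] at hN
        linarith
  let φ : C(puncturedTripod, twicePunctured) :=
    ⟨fun q => ⟨(sc q • q.1.1, sc q * q.1.2.1), by
      intro hz hy
      have hN := hnorm q
      simp only at hz hy
      rw [hz, hy, norm_zero] at hN
      rcases mul_eq_zero.mp q.2.2.1 with h | h
      · rw [h] at hy; simp at hy
      · rw [h] at hN; norm_num at hN⟩, by fun_prop⟩
  let ψ : C(twicePunctured, puncturedTripod) :=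
    ⟨fun p => ⟨(p.1.1, p.1.2 - cl 1 p.1.2, max 0 (1 - |p.1.2|)), by
      refine ⟨le_max_left _ _, ?_, ?_⟩
      · simp only
        rcases le_or_gt |p.1.2| 1 with h | h
        · rw [hcl 1 _ zero_le_one h, sub_self, zero_mul]
        · rw [max_eq_left (by linarith), mul_zero]
      · intro h
        simp only [Prod.mk_eq_zero] at h
        obtain ⟨h1, h2, h3⟩ := h
        refine p.2 h1 (le_antisymm (hcl' 1 _ zero_le_one (by linarith)) ?_)
        have := le_max_right 0 (1 - |p.1.2|)
        linarith⟩, by fun_prop⟩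
  let σ : C(puncturedTripod, puncturedTripod) :=
    ⟨fun q => ⟨bend 0 (sc q • q.1), hbend 0 le_rfl zero_le_one q⟩, by fun_prop⟩
  refine ⟨⟨φ, ψ, ContinuousMap.Homotopic.trans (g := σ) ?_ ?_, ?_⟩⟩
  · refine ContinuousMap.Homotopic.symm ⟨⟨⟨fun q => ⟨bend q.1 (sc q.2 • q.2.1),
      hbend _ q.1.2.1 q.1.2.2 q.2⟩, by fun_prop⟩, ?_, ?_⟩⟩
    · intro q; rfl
    · intro q
      apply Subtype.ext
      simp [φ, ψ, bend]
  · refine homotopic_of_segment_subset _ _ ?_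
    rintro q _ ⟨a, b, ha, hb, hab, rfl⟩
    have hσ : ((σ q : puncturedTripod) : ℂ × ℝ × ℝ) = sc q • q.1 := by
      refine Prod.ext rfl (Prod.ext ?_ ?_)
      · simp only [σ, bend, cl, ContinuousMap.coe_mk, neg_zero]
        simp
      · simp only [σ, bend, ContinuousMap.coe_mk, Prod.smul_snd, smul_eq_mul]
        rw [max_eq_left (by simp only [zero_sub, neg_nonpos]; exact abs_nonneg _)]
        ring
    have hpos' : 0 < a * sc q + b := by
      rcases ha.eq_or_lt with h | h
      · rw [← h] at hab ⊢; simp at hab ⊢; linarith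
      · have := hsc q; positivity
    rw [hσ, ContinuousMap.id_apply, smul_smul, ← add_smul]
    obtain ⟨hw, hyw, hne⟩ := q.2
    refine ⟨mul_nonneg hpos'.le hw, ?_, smul_ne_zero hpos'.ne' hne⟩
    simp only [Prod.smul_snd, Prod.smul_fst, smul_eq_mul]
    rw [mul_mul_mul_comm, hyw, mul_zero]
  · refine homotopic_of_segment_subset _ _ ?_
    rintro p _ ⟨a, b, ha, hb, hab, rfl⟩ hz hy
    have hl := hsc (ψ p)
    have hN := hnorm (ψ p)
    have hpos' : 0 < a * sc (ψ p) + b := by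
      rcases ha.eq_or_lt with h | h
      · rw [← h] at hab ⊢; simp at hab ⊢; linarith
      · positivity
    obtain ⟨⟨z, y⟩, hp⟩ := p
    set l := sc (ψ ⟨(z, y), hp⟩) with hldef
    simp only [φ, ContinuousMap.comp_apply, ContinuousMap.coe_mk, ContinuousMap.id_apply,
      Prod.fst_add, Prod.snd_add, Prod.smul_fst, Prod.smul_snd, smul_eq_mul, smul_smul,
      ← hldef] at hz hy
    simp only [ψ, ContinuousMap.coe_mk] at hz hy hN
    rw [← add_smul] at hz
    have hz0 : z = 0 := (smul_eq_zero.mp hz).resolve_left hpos'.ne'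
    have hy1 := hp hz0
    simp only at hy1
    rw [hz0, smul_zero, norm_zero, zero_add] at hN
    have hab3 : ∀ v : ℝ, 1 < v → a * 3 + b * v ≠ 1 := by
      intro v hv h
      rcases hb.eq_or_lt with h0 | h0
      · rw [← h0] at hab h; linarith
      · nlinarith [mul_pos h0 (sub_pos.mpr hv)]
    rcases lt_or_gt_of_ne hy1 with h | h
    · rw [hcl 1 y zero_le_one h.le, sub_self, mul_zero, mul_zero, zero_add, abs_mul,
        abs_of_nonneg hb] at hy
      nlinarith [abs_nonneg y]
    · rw [max_eq_left (by linarith), mul_zero, add_zero] at hN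
      rcases lt_abs.mp h with h | h
      · have : 0 ≤ y - cl 1 y := by
          simp only [cl]; rw [min_eq_left h.le]; norm_num; exact h.le
        rw [abs_of_nonneg (mul_nonneg hl.le this)] at hN
        rw [hN, abs_of_nonneg (by nlinarith)] at hy
        exact hab3 y h hy
      · have : y - cl 1 y ≤ 0 := by
          simp only [cl]; rw [min_eq_right (by linarith), max_eq_left (by linarith)]; linarith
        rw [abs_of_nonpos (mul_nonpos_of_nonneg_of_nonpos hl.le this)] at hN
        rw [show l * (y - cl 1 y) = -3 by linarith, abs_of_nonpos (by nlinarith)] at hy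
        exact hab3 (-y) h (by linarith)

theorem nonempty_puncturedTripod_homotopyEquiv_sphWedge :
    Nonempty (puncturedTripod ≃ₕ SphWedge 2 2) := by
  obtain ⟨e₁⟩ := nonempty_puncturedTripod_homotopyEquiv_twicePunctured
  obtain ⟨e₂⟩ := nonempty_twicePunctured_homotopyEquiv_tangentSpheres
  obtain ⟨e₃⟩ := nonempty_sphWedge_two_two_homeomorph
  exact ⟨(e₁.trans e₂).trans e₃.symm.toHomotopyEquiv⟩

/-! ### Models of the circle -/

theorem nonempty_compl_zero_homotopyEquiv_sphere {E : Type*} [NormedAddCommGroup E]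
    [NormedSpace ℝ E] : Nonempty (({0}ᶜ : Set E) ≃ₕ Metric.sphere (0 : E) 1) := by
  have hne : ∀ v : ({0}ᶜ : Set E), ‖(v : E)‖ ≠ 0 := fun v => norm_ne_zero_iff.mpr v.2
  refine nonempty_homotopyEquiv_of_segment_subset
    ⟨fun v => ⟨‖(v : E)‖⁻¹ • (v : E), by
      rw [mem_sphere_zero_iff_norm, norm_smul, norm_inv, norm_norm, inv_mul_cancel₀ (hne v)]⟩,
      by
        refine Continuous.subtype_mk ?_ _
        exact Continuous.smul (Continuous.inv₀ (by fun_prop) hne) (by fun_prop)⟩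
    ⟨fun v => ⟨v, ne_zero_of_mem_unit_sphere v⟩, by fun_prop⟩ ?_ ?_
  · rintro v _ ⟨a, b, ha, hb, hab, rfl⟩
    simp only [ContinuousMap.coe_mk, smul_smul, ← add_smul]
    refine smul_ne_zero ?_ v.2
    have hv : 0 < ‖(v : E)‖⁻¹ := inv_pos.mpr (norm_pos_iff.mpr v.2)
    rcases ha.eq_or_lt with h | h
    · rw [← h] at hab ⊢; simp at hab ⊢; linarith
    · positivity
  · intro v
    have hv : ‖(v : E)‖ = 1 := mem_sphere_zero_iff_norm.mp v.2
    simp [hv]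

theorem nonempty_sphWedge_one_homeomorph (m : ℕ) : Nonempty (SphWedge 1 m ≃ₜ Sph m) := by
  have hlift : ∀ a b, wedgeRel (fun _ : Fin 1 => Sph.base m) a b → a.2 = b.2 := by
    rintro a b ⟨i, j, rfl, rfl⟩; rfl
  refine ⟨⟨⟨Quot.lift (fun a => a.2) hlift, fun v => Quot.mk _ ⟨0, v⟩, ?_, fun v => rfl⟩,
    ?_, ?_⟩⟩
  · rintro ⟨i, v⟩
    rw [Subsingleton.elim i 0]
  · exact continuous_quot_lift hlift (continuous_sigma fun i => continuous_id)
  · exact continuous_quot_mk.comp continuous_sigmaMk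

theorem nonempty_compl_zero_homotopyEquiv_sphWedge :
    Nonempty (({0}ᶜ : Set ℂ) ≃ₕ SphWedge 1 1) := by
  obtain ⟨e₁⟩ := nonempty_compl_zero_homotopyEquiv_sphere (E := ℂ)
  obtain ⟨e₂⟩ := nonempty_sphWedge_one_homeomorph 1
  have e₃ : Metric.sphere (0 : ℂ) 1 ≃ₜ Sph 1 :=
    Complex.orthonormalBasisOneI.repr.toHomeomorph.subtype fun z => by simp
  exact ⟨(e₁.trans e₃.toHomotopyEquiv).trans e₂.symm.toHomotopyEquiv⟩

/-! ### The complex of cyclic windows of length four -/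

section Window

variable {m : ℕ} [NeZero m]

/-- The geometric simplex on the four consecutive vertices `i, i + 1, i + 2, i + 3` of `ZMod m`,
in barycentric coordinates. The condition `(j - i).val ≤ 3` says that `j` is one of the four when
`4 ≤ m`. -/
def windowSimplex (i : ZMod m) : Set (ZMod m → ℝ) :=
  {x | (∀ j, 0 ≤ x j) ∧ ∑ j, x j = 1 ∧ ∀ j, x j ≠ 0 → (j - i).val ≤ 3}

variable (m) in
/-- The geometric realization of the complex on `ZMod m` whose facets are the sets of four
cyclically consecutive vertices. -/
def windowComplex : Set (ZMod m → ℝ) := ⋃ i : ZMod m, windowSimplex i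

theorem convex_windowSimplex (i : ZMod m) : Convex ℝ (windowSimplex i) := by
  rintro x ⟨hx0, hx1, hxs⟩ y ⟨hy0, hy1, hys⟩ a b ha hb hab
  refine ⟨fun j => add_nonneg (mul_nonneg ha (hx0 j)) (mul_nonneg hb (hy0 j)), ?_, ?_⟩
  · simp [Finset.sum_add_distrib, ← Finset.mul_sum, hx1, hy1, hab]
  · intro j hj
    by_cases h : x j = 0
    · refine hys j fun h' => hj ?_
      simp [h, h']
    · exact hxs j h

theorem segment_subset_windowComplex {i : ZMod m} {x y : ZMod m → ℝ} (hx : x ∈ windowSimplex i)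
    (hy : y ∈ windowSimplex i) : segment ℝ x y ⊆ windowComplex m :=
  ((convex_windowSimplex i).segment_subset hx hy).trans (Set.subset_iUnion _ i)

theorem inv_sum_smul_mem_windowSimplex {h : ZMod m → ℝ} (h0 : ∀ j, 0 ≤ h j) (h1 : ∃ j, 0 < h j)
    {i : ZMod m} (hs : ∀ j, h j ≠ 0 → (j - i).val ≤ 3) :
    (∑ j, h j)⁻¹ • h ∈ windowSimplex i := by
  have hS : 0 < ∑ j, h j :=
    Finset.sum_pos' (fun j _ => h0 j) (h1.imp fun j hj => ⟨Finset.mem_univ _, hj⟩)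
  refine ⟨fun j => mul_nonneg (inv_nonneg.mpr hS.le) (h0 j), ?_, fun j hj => hs j fun h' => hj ?_⟩
  · simp only [Pi.smul_apply, smul_eq_mul, ← Finset.mul_sum]
    exact inv_mul_cancel₀ hS.ne'
  · simp [h']

/-! ### Roots of unity and tent functions -/

theorem stdAddChar_val (j : ZMod m) :
    ZMod.stdAddChar j = Complex.exp ((2 * Real.pi * j.val / m : ℝ) * Complex.I) := by
  rw [ZMod.stdAddChar_apply, ZMod.toCircle_apply]
  congr 1
  push_cast
  ring

theorem stdAddChar_intCast_im (k : ℤ) :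
    (ZMod.stdAddChar (k : ZMod m) : ℂ).im = Real.sin (2 * Real.pi * k / m) := by
  rw [ZMod.stdAddChar_coe, ← Complex.exp_ofReal_mul_I_im]
  congr 2
  push_cast
  ring

/-- The point of `ℂ` with barycentric coordinates `x` with respect to the `m`-th roots of unity. -/
noncomputable def rootCombination (x : ZMod m → ℝ) : ℂ := ∑ j, (x j : ℂ) * ZMod.stdAddChar j

/-- The `j`-th tent function: on the unit circle, it is supported in the open arc that joins the
two neighbors of the `j`-th root of unity. It is extended to `ℂ` homogeneously. -/
noncomputable def tent (j : ZMod m) (z : ℂ) : ℝ :=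
  max 0 ((z * ZMod.stdAddChar (-j)).re - Real.cos (2 * Real.pi / m) * ‖z‖)

theorem tent_nonneg (j : ZMod m) (z : ℂ) : 0 ≤ tent j z := le_max_left _ _

@[fun_prop]
theorem continuous_tent (j : ZMod m) : Continuous (tent j) := by unfold tent; fun_prop

@[fun_prop]
theorem continuous_rootCombination :
    Continuous (rootCombination : (ZMod m → ℝ) → ℂ) := by unfold rootCombination; fun_prop

@[simp]
theorem tent_zero (j : ZMod m) : tent j 0 = 0 := by simp [tent]

theorem norm_stdAddChar (j : ZMod m) : ‖(ZMod.stdAddChar j : ℂ)‖ = 1 := by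
  rw [ZMod.stdAddChar_apply]; exact Circle.norm_coe _

theorem tent_mul_stdAddChar (i j : ZMod m) (z : ℂ) :
    tent (j - i) (z * ZMod.stdAddChar (-i)) = tent j z := by
  rw [tent, tent, mul_assoc, ← AddChar.map_add_eq_mul, norm_mul, norm_stdAddChar, mul_one]
  congr 5
  ring

theorem tent_polar (j : ZMod m) {r : ℝ} (hr : 0 ≤ r) (θ : ℝ) :
    tent j (r * Complex.exp (θ * Complex.I)) =
      max 0 (r * (Real.cos (θ - 2 * Real.pi * j.val / m) - Real.cos (2 * Real.pi / m))) := by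
  rw [tent, AddChar.map_neg_eq_inv, stdAddChar_val, ← Complex.exp_neg, mul_assoc, ← Complex.exp_add,
    norm_mul, Complex.norm_exp_ofReal_mul_I, Complex.norm_real, Real.norm_of_nonneg hr,
    Complex.re_ofReal_mul, ← neg_mul, ← add_mul, ← Complex.ofReal_neg, ← Complex.ofReal_add,
    Complex.exp_ofReal_mul_I_re, ← sub_eq_add_neg]
  ring_nf

theorem val_le_of_tent_polar_ne_zero (hm : 2 ≤ m) {r θ : ℝ} (hr : 0 ≤ r) {a : ℕ} (h0 : 0 ≤ θ)
    (h1 : θ ≤ 2 * Real.pi * a / m) {j : ZMod m}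
    (hj : tent j (r * Complex.exp (θ * Complex.I)) ≠ 0) : j.val ≤ a := by
  by_contra! hlt
  refine hj ?_
  rw [tent_polar j hr, max_eq_left]
  refine mul_nonpos_of_nonneg_of_nonpos hr (sub_nonpos.mpr ?_)
  have hm0 : (0 : ℝ) < m := by exact_mod_cast (show 0 < m by omega)
  have hpi := Real.pi_pos
  have hm2 : (2 : ℝ) ≤ m := by exact_mod_cast hm
  have hb : 2 * Real.pi / m ≤ Real.pi := by
    rw [div_le_iff₀ hm0]; nlinarith
  have hc : 2 * Real.pi * a / m + 2 * Real.pi / m ≤ 2 * Real.pi * j.val / m := by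
    rw [← add_div]
    refine div_le_div_of_nonneg_right ?_ hm0.le
    have : (a : ℝ) + 1 ≤ j.val := by exact_mod_cast hlt
    nlinarith
  have hd : 2 * Real.pi * j.val / m + 2 * Real.pi / m ≤ 2 * Real.pi := by
    rw [← add_div, div_le_iff₀ hm0]
    have : (j.val : ℝ) + 1 ≤ m := by exact_mod_cast ZMod.val_lt j
    nlinarith
  have hpos : 0 ≤ 2 * Real.pi / m := by positivity
  rw [← Real.cos_neg, neg_sub]
  rcases le_total (2 * Real.pi * j.val / m - θ) Real.pi with h | h
  · exact Real.cos_le_cos_of_nonneg_of_le_pi hpos h (by linarith)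
  · rw [← Real.cos_two_pi_sub]
    exact Real.cos_le_cos_of_nonneg_of_le_pi hpos (by linarith) (by linarith)

/-- A nonzero `z` lies in the sector between two consecutive roots of unity. The tent function of the
first of them is positive, and only those of these two roots can be nonzero. -/
theorem exists_tent_pos (hm : 2 ≤ m) {z : ℂ} (hz : z ≠ 0) :
    ∃ i : ZMod m, 0 < tent i z ∧ ∀ j, tent j z ≠ 0 → (j - i).val ≤ 1 := by
  have hm0 : (0 : ℝ) < m := by exact_mod_cast (show 0 < m by omega)
  have hm2 : (2 : ℝ) ≤ m := by exact_mod_cast hm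
  have hpi := Real.pi_pos
  set k : ℤ := ⌊Complex.arg z * m / (2 * Real.pi)⌋ with hk
  set ψ : ℝ := Complex.arg z - 2 * Real.pi * k / m with hψ
  have h0 : 0 ≤ ψ := by
    have := Int.floor_le (Complex.arg z * m / (2 * Real.pi))
    rw [← hk, le_div_iff₀ (by positivity)] at this
    rw [hψ, sub_nonneg, div_le_iff₀ hm0]
    linarith
  have h1 : ψ < 2 * Real.pi / m := by
    have := Int.lt_floor_add_one (Complex.arg z * m / (2 * Real.pi))
    rw [← hk, div_lt_iff₀ (by positivity)] at this
    rw [hψ, sub_lt_iff_lt_add, ← add_div, lt_div_iff₀ hm0]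
    linarith
  have hrot : z * ZMod.stdAddChar (-(k : ZMod m)) = ‖z‖ * Complex.exp (ψ * Complex.I) := by
    conv_lhs => rw [← Complex.norm_mul_exp_arg_mul_I z]
    rw [AddChar.map_neg_eq_inv, ZMod.stdAddChar_coe, ← Complex.exp_neg, mul_assoc,
      ← Complex.exp_add, hψ]
    congr 2
    push_cast
    ring
  refine ⟨k, ?_, fun j hj => ?_⟩
  · rw [← tent_mul_stdAddChar k, sub_self, hrot, tent_polar _ (norm_nonneg z)]
    refine lt_max_of_lt_right (mul_pos (norm_pos_iff.mpr hz) (sub_pos.mpr ?_))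
    rw [ZMod.val_zero]
    simp only [Nat.cast_zero, mul_zero, zero_div, sub_zero]
    refine Real.cos_lt_cos_of_nonneg_of_le_pi h0 ?_ h1
    rw [div_le_iff₀ hm0]; nlinarith
  · rw [← tent_mul_stdAddChar k, hrot] at hj
    exact val_le_of_tent_polar_ne_zero hm (norm_nonneg z) h0 
      (by rw [Nat.cast_one, mul_one]; exact h1.le) hj

theorem rootCombination_mul (x : ZMod m → ℝ) (i : ZMod m) :
    rootCombination x * ZMod.stdAddChar (-i) = ∑ j, (x j : ℂ) * ZMod.stdAddChar (j - i) := by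
  rw [rootCombination, Finset.sum_mul]
  refine Finset.sum_congr rfl fun j _ => ?_
  rw [mul_assoc, ← AddChar.map_add_eq_mul, sub_eq_add_neg]

theorem stdAddChar_im_nonneg (hm : 6 ≤ m) {k : ZMod m} (hk : k.val ≤ 3) :
    0 ≤ (ZMod.stdAddChar k : ℂ).im := by
  have hm0 : (0 : ℝ) < m := by exact_mod_cast (show 0 < m by omega)
  have hm6 : (6 : ℝ) ≤ m := by exact_mod_cast hm
  have hk3 : (k.val : ℝ) ≤ 3 := by exact_mod_cast hk
  have hpi := Real.pi_pos
  rw [stdAddChar_val, Complex.exp_ofReal_mul_I_im]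
  refine Real.sin_nonneg_of_nonneg_of_le_pi (by positivity) ?_
  rw [div_le_iff₀ hm0]
  nlinarith

theorem stdAddChar_sub_three_im_nonpos (hm : 6 ≤ m) {k : ZMod m} (hk : k.val ≤ 3) :
    (ZMod.stdAddChar (k - 3) : ℂ).im ≤ 0 := by
  have hm0 : (0 : ℝ) < m := by exact_mod_cast (show 0 < m by omega)
  have hm6 : (6 : ℝ) ≤ m := by exact_mod_cast hm
  have hk3 : (k.val : ℝ) ≤ 3 := by exact_mod_cast hk
  have hk0 : (0 : ℝ) ≤ k.val := Nat.cast_nonneg _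
  have hpi := Real.pi_pos
  have hcast : k - 3 = (((k.val : ℤ) - 3 : ℤ) : ZMod m) := by
    push_cast
    rw [ZMod.natCast_zmod_val]
  rw [hcast, stdAddChar_intCast_im]
  refine Real.sin_nonpos_of_nonpos_of_neg_pi_le ?_ ?_
  · refine div_nonpos_of_nonpos_of_nonneg (mul_nonpos_of_nonneg_of_nonpos (by positivity) ?_) hm0.le
    push_cast
    linarith
  · rw [le_div_iff₀ hm0]
    push_cast
    nlinarith

/-- A convex combination of consecutive roots of unity lies in the cone that they span, so only the
tent functions of these roots can be nonzero there. -/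
theorem val_le_of_tent_rootCombination_ne_zero (hm : 6 ≤ m) {i : ZMod m} {x : ZMod m → ℝ}
    (hx : x ∈ windowSimplex i) {j : ZMod m} (hj : tent j (rootCombination x) ≠ 0) :
    (j - i).val ≤ 3 := by
  obtain ⟨hx0, -, hxs⟩ := hx
  have hm0 : (0 : ℝ) < m := by exact_mod_cast (show 0 < m by omega)
  have hpi := Real.pi_pos
  set z := rootCombination x * ZMod.stdAddChar (-i) with hz
  have h1 : 0 ≤ z.im := by
    rw [hz, rootCombination_mul, Complex.im_sum]
    refine Finset.sum_nonneg fun k _ => ?_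
    rw [Complex.im_ofReal_mul]
    by_cases hk : x k = 0
    · simp [hk]
    · exact mul_nonneg (hx0 k) (stdAddChar_im_nonneg hm (hxs k hk))
  have h2 : (z * ZMod.stdAddChar (-3 : ZMod m)).im ≤ 0 := by
    rw [hz, mul_assoc, ← AddChar.map_add_eq_mul, ← neg_add, rootCombination_mul, Complex.im_sum]
    refine Finset.sum_nonpos fun k _ => ?_
    rw [Complex.im_ofReal_mul]
    by_cases hk : x k = 0
    · simp [hk]
    · rw [← sub_sub]
      exact mul_nonpos_of_nonneg_of_nonpos (hx0 k) (stdAddChar_sub_three_im_nonpos hm (hxs k hk))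
  rw [← tent_mul_stdAddChar i, ← hz] at hj
  have hz0 : z ≠ 0 := by
    intro h; rw [h] at hj; exact hj (tent_zero _)
  have hpolar := Complex.norm_mul_exp_arg_mul_I z
  have harg : 0 ≤ Complex.arg z := Complex.arg_nonneg_iff.mpr h1
  rw [← hpolar] at hj
  refine val_le_of_tent_polar_ne_zero (by omega) (norm_nonneg z) harg ?_ hj
  by_contra! hlt
  have h3 : ZMod.stdAddChar (-3 : ZMod m)
      = Complex.exp ((-(2 * Real.pi * 3 / m) : ℝ) * Complex.I) := by
    have : (-3 : ZMod m) = ((-3 : ℤ) : ZMod m) := by push_cast; rfl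
    rw [this, ZMod.stdAddChar_coe]
    congr 1
    push_cast
    ring
  rw [← hpolar, h3, mul_assoc, ← Complex.exp_add, Complex.im_ofReal_mul, ← add_mul,
    ← Complex.ofReal_add, Complex.exp_ofReal_mul_I_im] at h2
  refine absurd h2 (not_le.mpr (mul_pos (norm_pos_iff.mpr hz0) (Real.sin_pos_of_pos_of_lt_pi ?_ ?_)))
  · push_cast at hlt; linarith
  · have := Complex.arg_le_pi z
    have : 0 < 2 * Real.pi * 3 / m := by positivity
    linarith

theorem re_mul_conj_pos_of_tent_pos (hm : 4 ≤ m) {j : ZMod m} {z : ℂ} (hj : 0 < tent j z) :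
    0 < (ZMod.stdAddChar j * (starRingEnd ℂ) z).re := by
  have hm0 : (0 : ℝ) < m := by exact_mod_cast (show 0 < m by omega)
  have hm4 : (4 : ℝ) ≤ m := by exact_mod_cast hm
  have hpi := Real.pi_pos
  have hcos : 0 ≤ Real.cos (2 * Real.pi / m) := by
    refine Real.cos_nonneg_of_neg_pi_div_two_le_of_le ?_ ?_
    · have : 0 ≤ 2 * Real.pi / m := by positivity
      linarith
    · rw [div_le_iff₀ hm0]; nlinarith
  have h : 0 < (z * ZMod.stdAddChar (-j)).re := by
    have := (lt_max_iff.mp hj).resolve_left (lt_irrefl _)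
    have := mul_nonneg hcos (norm_nonneg z)
    linarith
  rwa [AddChar.map_neg_eq_conj, ← Complex.conj_re, map_mul, Complex.conj_conj, mul_comm] at h

/-- The combination of the roots of unity with weights the tent functions at `z` lies in the open
half plane around `z`. -/
theorem re_sum_tent_mul_conj_pos (hm : 4 ≤ m) {z : ℂ} (hz : z ≠ 0) :
    0 < ((∑ j : ZMod m, (tent j z : ℂ) * ZMod.stdAddChar j) * (starRingEnd ℂ) z).re := by
  obtain ⟨i, hi, -⟩ := exists_tent_pos (m := m) (by omega) hz
  rw [Finset.sum_mul, Complex.re_sum]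
  refine Finset.sum_pos' (fun j _ => ?_) ⟨i, Finset.mem_univ _, ?_⟩
  · rw [mul_assoc, Complex.re_ofReal_mul]
    rcases (tent_nonneg j z).eq_or_lt with h | h
    · rw [← h, zero_mul]
    · exact (mul_pos h (re_mul_conj_pos_of_tent_pos hm h)).le
  · rw [mul_assoc, Complex.re_ofReal_mul]
    exact mul_pos hi (re_mul_conj_pos_of_tent_pos hm hi)

theorem rootCombination_ne_zero (hm : 7 ≤ m) {i : ZMod m} {x : ZMod m → ℝ}
    (hx : x ∈ windowSimplex i) : rootCombination x ≠ 0 := by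
  obtain ⟨hx0, hx1, hxs⟩ := hx
  have hm0 : (0 : ℝ) < m := by exact_mod_cast (show 0 < m by omega)
  have hm7 : (7 : ℝ) ≤ m := by exact_mod_cast hm
  have hpi := Real.pi_pos
  intro h0
  -- all vertices of the window have positive component along the bisector of their cone
  have h : ((rootCombination x * ZMod.stdAddChar (-i)) *
      Complex.exp ((-(3 * Real.pi / m) : ℝ) * Complex.I)).re = 0 := by simp [h0]
  rw [rootCombination_mul, Finset.sum_mul, Complex.re_sum] at h
  have hterm : ∀ j, ((x j : ℂ) * ZMod.stdAddChar (j - i) *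
      Complex.exp ((-(3 * Real.pi / m) : ℝ) * Complex.I)).re
      = x j * Real.cos (2 * Real.pi * (j - i).val / m + -(3 * Real.pi / m)) := by
    intro j
    rw [stdAddChar_val, mul_assoc, ← Complex.exp_add, ← add_mul, Complex.re_ofReal_mul,
      ← Complex.ofReal_add, Complex.exp_ofReal_mul_I_re]
  have hcos : ∀ j, x j ≠ 0 →
      0 < Real.cos (2 * Real.pi * (j - i).val / m + -(3 * Real.pi / m)) := by
    intro j hj
    have hk3 : ((j - i).val : ℝ) ≤ 3 := by exact_mod_cast hxs j hj
    have hk0 : (0 : ℝ) ≤ (j - i).val := Nat.cast_nonneg _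
    rw [← sub_eq_add_neg, ← sub_div]
    refine Real.cos_pos_of_mem_Ioo ⟨?_, ?_⟩
    · rw [lt_div_iff₀ hm0]; nlinarith
    · rw [div_lt_iff₀ hm0]; nlinarith
  obtain ⟨j, hj⟩ : ∃ j, x j ≠ 0 := by
    by_contra! hall
    simp [hall] at hx1
  refine absurd h (ne_of_gt (Finset.sum_pos' (fun k _ => ?_) ⟨j, Finset.mem_univ _, ?_⟩))
  · rw [hterm]
    by_cases hk : x k = 0
    · simp [hk]
    · exact mul_nonneg (hx0 k) (hcos k hk).le
  · rw [hterm]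
    exact mul_pos (lt_of_le_of_ne (hx0 j) hj.symm) (hcos j hj)

/-! ### At least seven vertices: the circle -/

/-- Up to homotopy, `rootCombination` is inverse to the normalized tent functions: one composition
stays in the simplex of the given point, the other in the half plane around it. -/
theorem nonempty_windowComplex_homotopyEquiv_compl_zero (hm : 7 ≤ m) :
    Nonempty (windowComplex m ≃ₕ ({0}ᶜ : Set ℂ)) := by
  have hW : ∀ x ∈ windowComplex m, ∃ i, x ∈ windowSimplex i := fun x hx => Set.mem_iUnion.mp hx
  have htent : ∀ z : ({0}ᶜ : Set ℂ), 0 < ∑ j : ZMod m, tent j (z : ℂ) := by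
    intro z
    obtain ⟨i, hi, -⟩ := exists_tent_pos (m := m) (by omega) z.2
    exact Finset.sum_pos' (fun j _ => tent_nonneg j _) ⟨i, Finset.mem_univ _, hi⟩
  let g : ℂ → ZMod m → ℝ := fun z => (∑ j : ZMod m, tent j z)⁻¹ • fun j => tent j z
  have hg : ∀ z : ℂ, z ≠ 0 → ∀ i : ZMod m, (∀ j : ZMod m, tent j z ≠ 0 → (j - i).val ≤ 3) →
      g z ∈ windowSimplex i := by
    intro z hz i hi
    obtain ⟨k, hk, -⟩ := exists_tent_pos (m := m) (by omega) hz
    exact inv_sum_smul_mem_windowSimplex (fun j => tent_nonneg j z) ⟨k, hk⟩ hi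
  refine nonempty_homotopyEquiv_of_segment_subset
    ⟨fun x => ⟨rootCombination x.1, by
      obtain ⟨i, hi⟩ := hW _ x.2
      exact rootCombination_ne_zero hm hi⟩, by fun_prop⟩
    ⟨fun z => ⟨g z.1, by
      obtain ⟨i, -, hi⟩ := exists_tent_pos (m := m) (by omega) z.2
      exact Set.mem_iUnion.mpr ⟨i, hg _ z.2 i fun j hj => (hi j hj).trans (by norm_num)⟩⟩,
      by
        refine Continuous.subtype_mk ?_ _
        exact Continuous.smul (Continuous.inv₀ (by fun_prop) fun z => (htent z).ne')
          (by fun_prop)⟩ ?_ ?_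
  · intro x
    obtain ⟨i, hi⟩ := hW _ x.2
    exact segment_subset_windowComplex (hg _ (rootCombination_ne_zero hm hi) i
      fun j hj => val_le_of_tent_rootCombination_ne_zero (by omega) hi hj) hi
  · rintro z _ ⟨a, b, ha, hb, hab, rfl⟩ h0
    have hS := htent z
    have h1 := re_sum_tent_mul_conj_pos (m := m) (by omega) z.2
    have h2 : 0 < ((z : ℂ) * (starRingEnd ℂ) (z : ℂ)).re := by
      rw [Complex.mul_conj, Complex.ofReal_re]
      exact Complex.normSq_pos.mpr z.2
    have h3 : rootCombination (g z)
        = ((∑ j : ZMod m, tent j (z : ℂ))⁻¹ : ℝ) * ∑ j : ZMod m, (tent j (z : ℂ) : ℂ) *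
          ZMod.stdAddChar j := by
      rw [rootCombination, Finset.mul_sum]
      refine Finset.sum_congr rfl fun j _ => ?_
      simp only [g, Pi.smul_apply, smul_eq_mul]
      push_cast
      ring
    have h4 := congrArg (fun w => (w * (starRingEnd ℂ) (z : ℂ)).re) h0
    simp only [ContinuousMap.coe_mk, h3, add_mul, Complex.add_re, zero_mul, Complex.zero_re,
      Complex.real_smul, mul_assoc, Complex.re_ofReal_mul] at h4
    have h5 := mul_pos (inv_pos.mpr hS) h1
    rcases ha.eq_or_lt with h | h
    · rw [← h] at hab h4
      rw [zero_add] at hab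
      rw [hab] at h4
      linarith
    · have := mul_pos h h5
      have := mul_nonneg hb h2.le
      linarith

end Window

/-! ### Six vertices: a wedge of two 2-spheres -/

/-- The weights on the vertices `j` and `j + 3` of the hexagon that correspond to the position on
the tripod: each leg belongs to a pair of antipodal vertices. -/
noncomputable def legWeight (q : ℂ × ℝ × ℝ) (j : ZMod 6) : ℝ :=
  if j = 0 ∨ j = 3 then max q.2.1 0 else if j = 1 ∨ j = 4 then max (-q.2.1) 0 else q.2.2

/-- The coordinates on the hexagon complex: the combination of the 6th roots of unity, and on each
leg of the tripod the smaller of the two weights of an antipodal pair. A window contains exactly one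
such pair, so at most one leg is used. -/
noncomputable def hexagonMap (x : ZMod 6 → ℝ) : ℂ × ℝ × ℝ :=
  (rootCombination x, min (x 0) (x 3) - min (x 1) (x 4), min (x 2) (x 5))

/-- The barycentric coordinates that spread a point of `ℂ × ℝ × ℝ` over the six vertices. -/
noncomputable def hexagonWeights (q : ℂ × ℝ × ℝ) : ZMod 6 → ℝ :=
  (∑ j, (tent j q.1 + legWeight q j))⁻¹ • fun j => tent j q.1 + legWeight q j

theorem zmod_six_cases (j : ZMod 6) : j = 0 ∨ j = 1 ∨ j = 2 ∨ j = 3 ∨ j = 4 ∨ j = 5 := by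
  revert j; decide

theorem legWeight_nonneg {q : ℂ × ℝ × ℝ} (hq : q ∈ puncturedTripod) (j : ZMod 6) :
    0 ≤ legWeight q j := by
  unfold legWeight
  split_ifs
  · exact le_max_right _ _
  · exact le_max_right _ _
  · exact hq.1

theorem legWeight_add_three (q : ℂ × ℝ × ℝ) (j : ZMod 6) :
    legWeight q (j + 3) = legWeight q j := by
  have h1 : (j + 3 = 0 ∨ j + 3 = 3) ↔ (j = 0 ∨ j = 3) := by revert j; decide
  have h2 : (j + 3 = 1 ∨ j + 3 = 4) ↔ (j = 1 ∨ j = 4) := by revert j; decide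
  simp only [legWeight, h1, h2]

@[fun_prop]
theorem continuous_legWeight (j : ZMod 6) : Continuous fun q => legWeight q j := by
  unfold legWeight
  split_ifs <;> fun_prop

theorem exists_legWeight_support {q : ℂ × ℝ × ℝ} (hq : q ∈ puncturedTripod) :
    ∃ c : ZMod 6, ∀ j, legWeight q j ≠ 0 → j = c ∨ j = c + 3 := by
  obtain ⟨hw, hyw, -⟩ := hq
  rcases lt_trichotomy q.2.1 0 with hy | hy | hy
  · have hw0 : q.2.2 = 0 := (mul_eq_zero.mp hyw).resolve_left hy.ne
    refine ⟨1, fun j hj => ?_⟩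
    rcases zmod_six_cases j with rfl | rfl | rfl | rfl | rfl | rfl <;>
      simp +decide [legWeight, hw0, hy.le] at hj ⊢
  · refine ⟨2, fun j hj => ?_⟩
    rcases zmod_six_cases j with rfl | rfl | rfl | rfl | rfl | rfl <;>
      simp +decide [legWeight, hy] at hj ⊢
  · have hw0 : q.2.2 = 0 := (mul_eq_zero.mp hyw).resolve_left hy.ne'
    refine ⟨0, fun j hj => ?_⟩
    rcases zmod_six_cases j with rfl | rfl | rfl | rfl | rfl | rfl <;>
      simp +decide [legWeight, hw0, hy.le] at hj ⊢

theorem exists_tent_add_legWeight_pos {q : ℂ × ℝ × ℝ} (hq : q ∈ puncturedTripod) :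
    ∃ j, 0 < tent j q.1 + legWeight q j := by
  by_cases hz : q.1 = 0
  · have hpos : ∃ j, 0 < legWeight q j := by
      by_contra! hall
      have h0 := hall 0
      have h1 := hall 1
      have h2 := hall 2
      simp +decide [legWeight] at h0 h1 h2
      exact hq.2.2 (Prod.ext hz (Prod.ext (le_antisymm h0 h1) (le_antisymm h2 hq.1)))
    obtain ⟨j, hj⟩ := hpos
    exact ⟨j, add_pos_of_nonneg_of_pos (tent_nonneg _ _) hj⟩
  · obtain ⟨i, hi, -⟩ := exists_tent_pos (m := 6) (by norm_num) hz
    exact ⟨i, add_pos_of_pos_of_nonneg hi (legWeight_nonneg hq i)⟩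

theorem sum_tent_add_legWeight_pos {q : ℂ × ℝ × ℝ} (hq : q ∈ puncturedTripod) :
    0 < ∑ j, (tent j q.1 + legWeight q j) := by
  obtain ⟨j, hj⟩ := exists_tent_add_legWeight_pos hq
  exact Finset.sum_pos' (fun j _ => add_nonneg (tent_nonneg _ _) (legWeight_nonneg hq j))
    ⟨j, Finset.mem_univ _, hj⟩

theorem hexagonWeights_mem_windowSimplex {q : ℂ × ℝ × ℝ} (hq : q ∈ puncturedTripod) {i : ZMod 6}
    (h1 : ∀ j : ZMod 6, tent j q.1 ≠ 0 → (j - i).val ≤ 3)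
    (h2 : ∀ j, legWeight q j ≠ 0 → (j - i).val ≤ 3) : hexagonWeights q ∈ windowSimplex i := by
  refine inv_sum_smul_mem_windowSimplex
    (fun j => add_nonneg (tent_nonneg _ _) (legWeight_nonneg hq j))
    (exists_tent_add_legWeight_pos hq) fun j hj => ?_
  by_cases h : tent j q.1 = 0
  · exact h2 j fun h' => hj (by rw [h, h', add_zero])
  · exact h1 j h

theorem hexagonWeights_mem_windowComplex {q : ℂ × ℝ × ℝ} (hq : q ∈ puncturedTripod) :
    hexagonWeights q ∈ windowComplex 6 := by
  obtain ⟨c, hc⟩ := exists_legWeight_support hq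
  obtain ⟨i, hi⟩ : ∃ i : ZMod 6, ∀ j : ZMod 6, tent j q.1 ≠ 0 → (j - i).val ≤ 1 := by
    by_cases hz : q.1 = 0
    · exact ⟨0, fun j hj => absurd (by rw [hz, tent_zero]) hj⟩
    · obtain ⟨i, -, hi⟩ := exists_tent_pos (m := 6) (by norm_num) hz
      exact ⟨i, hi⟩
  -- an edge of the hexagon and a pair of antipodal vertices always lie in a common window
  obtain ⟨k, hk1, hk2⟩ : ∃ k : ZMod 6, (∀ j : ZMod 6, (j - i).val ≤ 1 → (j - k).val ≤ 3) ∧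
      ∀ j : ZMod 6, (j = c ∨ j = c + 3) → (j - k).val ≤ 3 := by
    clear hi hc
    revert i c
    decide
  exact Set.mem_iUnion.mpr ⟨k, hexagonWeights_mem_windowSimplex hq (fun j hj => hk1 j (hi j hj))
    fun j hj => hk2 j (hc j hj)⟩

theorem stdAddChar_add_three (j : ZMod 6) :
    (ZMod.stdAddChar (j + 3) : ℂ) = -ZMod.stdAddChar j := by
  have h : (ZMod.stdAddChar (3 : ZMod 6) : ℂ) = -1 := by
    have : (3 : ZMod 6) = ((3 : ℤ) : ZMod 6) := by push_cast; rfl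
    rw [this, ZMod.stdAddChar_coe, ← Complex.exp_pi_mul_I]
    congr 1
    push_cast
    ring
  rw [AddChar.map_add_eq_mul, h, mul_neg_one]

theorem tent_eq_zero_or_tent_add_three_eq_zero (j : ZMod 6) (z : ℂ) :
    tent j z = 0 ∨ tent (j + 3) z = 0 := by
  by_contra! h
  have h1 := re_mul_conj_pos_of_tent_pos (by norm_num) (lt_of_le_of_ne (tent_nonneg _ _) h.1.symm)
  have h2 := re_mul_conj_pos_of_tent_pos (by norm_num) (lt_of_le_of_ne (tent_nonneg _ _) h.2.symm)
  rw [stdAddChar_add_three, neg_mul, Complex.neg_re] at h2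
  linarith

theorem min_hexagonWeights {q : ℂ × ℝ × ℝ} (hq : q ∈ puncturedTripod) (j : ZMod 6) :
    min (hexagonWeights q j) (hexagonWeights q (j + 3))
      = (∑ j, (tent j q.1 + legWeight q j))⁻¹ * legWeight q j := by
  simp only [hexagonWeights, Pi.smul_apply, smul_eq_mul, legWeight_add_three]
  rw [← mul_min_of_nonneg _ _ (inv_nonneg.mpr (sum_tent_add_legWeight_pos hq).le),
    min_add_add_right]
  congr 1
  rw [add_eq_right]
  rcases tent_eq_zero_or_tent_add_three_eq_zero j q.1 with h | h
  · rw [h, min_eq_left (tent_nonneg _ _)]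
  · rw [h, min_eq_right (tent_nonneg _ _)]

theorem sum_legWeight_mul_stdAddChar (q : ℂ × ℝ × ℝ) :
    ∑ j : ZMod 6, (legWeight q j : ℂ) * ZMod.stdAddChar j = 0 := by
  have h : ∑ j : ZMod 6, (legWeight q j : ℂ) * ZMod.stdAddChar j
      = -∑ j : ZMod 6, (legWeight q j : ℂ) * ZMod.stdAddChar j := by
    conv_lhs => rw [← Equiv.sum_comp (Equiv.addRight (3 : ZMod 6))]
    simp [stdAddChar_add_three, legWeight_add_three]
  exact self_eq_neg.mp h

theorem hexagonMap_hexagonWeights {q : ℂ × ℝ × ℝ} (hq : q ∈ puncturedTripod) :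
    hexagonMap (hexagonWeights q) = (∑ j, (tent j q.1 + legWeight q j))⁻¹ •
      ((∑ j : ZMod 6, (tent j q.1 : ℂ) * ZMod.stdAddChar j, q.2.1, q.2.2) : ℂ × ℝ × ℝ) := by
  refine Prod.ext ?_ (Prod.ext ?_ ?_)
  · simp only [hexagonMap, Prod.smul_fst, Complex.real_smul, rootCombination]
    rw [← add_zero (∑ j : ZMod 6, (tent j q.1 : ℂ) * ZMod.stdAddChar j),
      ← sum_legWeight_mul_stdAddChar q, ← Finset.sum_add_distrib, Finset.mul_sum]
    refine Finset.sum_congr rfl fun j _ => ?_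
    simp only [hexagonWeights, Pi.smul_apply, smul_eq_mul, Complex.ofReal_mul, Complex.ofReal_add]
    ring
  · have h0 := min_hexagonWeights hq 0
    have h1 := min_hexagonWeights hq 1
    rw [show (0 : ZMod 6) + 3 = 3 from rfl] at h0
    rw [show (1 : ZMod 6) + 3 = 4 from rfl] at h1
    simp only [hexagonMap, Prod.smul_fst, Prod.smul_snd, smul_eq_mul, h0, h1, ← mul_sub]
    congr 1
    simp +decide only [legWeight, if_true, if_false]
    rcases le_total q.2.1 0 with h | h
    · rw [max_eq_right h, max_eq_left (by linarith)]; ring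
    · rw [max_eq_left h, max_eq_right (by linarith)]; ring
  · have h2 := min_hexagonWeights hq 2
    rw [show (2 : ZMod 6) + 3 = 5 from rfl] at h2
    simp only [hexagonMap, Prod.smul_snd, smul_eq_mul, h2]
    congr 1

theorem apply_ne_zero_of_legWeight_hexagonMap {x : ZMod 6 → ℝ} (hx : ∀ j, 0 ≤ x j) {j : ZMod 6}
    (hj : legWeight (hexagonMap x) j ≠ 0) : x j ≠ 0 := by
  intro h0
  refine hj ?_
  rcases zmod_six_cases j with rfl | rfl | rfl | rfl | rfl | rfl <;>
    simp +decide [legWeight, hexagonMap, h0, hx]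

theorem min_eq_zero_of_window {x : ZMod 6 → ℝ} {i : ZMod 6} (hx : x ∈ windowSimplex i)
    {j : ZMod 6} (hj : i ≠ j) (hj' : i ≠ j + 3) : min (x j) (x (j + 3)) = 0 := by
  obtain ⟨hx0, -, hxs⟩ := hx
  have h : ¬ ((j - i).val ≤ 3 ∧ (j + 3 - i).val ≤ 3) := by
    clear hxs
    revert i j; decide
  by_cases h1 : x j = 0
  · rw [h1, min_eq_left (hx0 _)]
  · have h2 : x (j + 3) = 0 := by
      by_contra h2
      exact h ⟨hxs _ h1, hxs _ h2⟩
    rw [h2, min_eq_right (hx0 _)]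

/-- In a window, the combination of the roots of unity vanishes only at the midpoint of the edge
between its two antipodal vertices. -/
theorem min_pos_of_rootCombination_eq_zero {x : ZMod 6 → ℝ} {i : ZMod 6} (hx : x ∈ windowSimplex i)
    (h0 : rootCombination x = 0) : 0 < min (x i) (x (i + 3)) := by
  obtain ⟨hx0, hx1, hxs⟩ := hx
  have h := rootCombination_mul x i
  rw [h0, zero_mul, ← Equiv.sum_comp (Equiv.addLeft i)] at h
  rw [← Equiv.sum_comp (Equiv.addLeft i)] at hx1
  simp only [Equiv.coe_addLeft, add_sub_cancel_left] at h hx1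
  have hs : ∀ k : ZMod 6, 3 < k.val → x (i + k) = 0 := by
    intro k hk
    by_contra hne
    have := hxs _ hne
    rw [add_sub_cancel_left] at this
    omega
  have hsum : ∀ f : ZMod 6 → ℝ, (∀ k, 3 < k.val → f k = 0) →
      ∑ k, f k = f 0 + f 1 + f 2 + f 3 := by
    intro f hf
    have h4 : f 4 = 0 := hf 4 (by decide)
    have h5 : f 5 = 0 := hf 5 (by decide)
    have : ∑ k, f k = f 0 + f 1 + f 2 + f 3 + f 4 + f 5 := Fin.sum_univ_six f
    rw [this, h4, h5, add_zero, add_zero]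
  have e1 : (ZMod.stdAddChar (1 : ZMod 6) : ℂ) =
      Complex.exp ((Real.pi / 3 : ℝ) * Complex.I) := by
    have : (1 : ZMod 6) = ((1 : ℤ) : ZMod 6) := by push_cast; rfl
    rw [this, ZMod.stdAddChar_coe]
    congr 1
    push_cast
    ring
  have e2 : (ZMod.stdAddChar (2 : ZMod 6) : ℂ) =
      Complex.exp ((Real.pi - Real.pi / 3 : ℝ) * Complex.I) := by
    have : (2 : ZMod 6) = ((2 : ℤ) : ZMod 6) := by push_cast; rfl
    rw [this, ZMod.stdAddChar_coe]
    congr 1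
    push_cast
    ring
  have e3 : (ZMod.stdAddChar (3 : ZMod 6) : ℂ) = -1 := by
    have := stdAddChar_add_three 0
    rwa [zero_add, AddChar.map_zero_eq_one] at this
  have him := congrArg Complex.im h
  have hre := congrArg Complex.re h
  rw [Complex.im_sum, hsum _ fun k hk => by simp [hs k hk]] at him
  rw [Complex.re_sum, hsum _ fun k hk => by simp [hs k hk]] at hre
  rw [hsum _ hs] at hx1
  have hsin : Real.sin (Real.pi - Real.pi / 3) = √3 / 2 := by
    rw [Real.sin_pi_sub, Real.sin_pi_div_three]
  have hcos : Real.cos (Real.pi - Real.pi / 3) = -(1 / 2) := by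
    rw [Real.cos_pi_sub, Real.cos_pi_div_three]
  rw [e1, e2, e3, AddChar.map_zero_eq_one] at him hre
  simp only [Complex.re_ofReal_mul, Complex.im_ofReal_mul, Complex.exp_ofReal_mul_I_re,
    Complex.exp_ofReal_mul_I_im, hsin, hcos, Real.sin_pi_div_three, Real.cos_pi_div_three,
    Complex.neg_re, Complex.neg_im, Complex.one_re, Complex.one_im, Complex.zero_re,
    Complex.zero_im, add_zero] at him hre hx1
  have h3 : (0 : ℝ) < √3 := by positivity
  have h12 : x (i + 1) + x (i + 2) = 0 := by
    have : (x (i + 1) + x (i + 2)) * (√3 / 2) = 0 := by linarith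
    exact (mul_eq_zero.mp this).resolve_right (by positivity)
  have := hx0 (i + 1)
  have := hx0 (i + 2)
  refine lt_min ?_ ?_ <;> linarith

theorem hexagonMap_mem_puncturedTripod {x : ZMod 6 → ℝ} {i : ZMod 6} (hx : x ∈ windowSimplex i) :
    hexagonMap x ∈ puncturedTripod := by
  have hx0 := hx.1
  have m0 := @min_eq_zero_of_window x i hx 0
  have m1 := @min_eq_zero_of_window x i hx 1
  have m2 := @min_eq_zero_of_window x i hx 2
  rw [show (0 : ZMod 6) + 3 = 3 from rfl] at m0
  rw [show (1 : ZMod 6) + 3 = 4 from rfl] at m1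
  rw [show (2 : ZMod 6) + 3 = 5 from rfl] at m2
  refine ⟨le_min (hx0 _) (hx0 _), ?_, fun h => ?_⟩
  · by_cases hi : i = 2 ∨ i = 5
    · simp only [hexagonMap]
      rw [m0 (by rcases hi with rfl | rfl <;> decide) (by rcases hi with rfl | rfl <;> decide),
        m1 (by rcases hi with rfl | rfl <;> decide) (by rcases hi with rfl | rfl <;> decide),
        sub_zero, zero_mul]
    · rw [not_or] at hi
      simp only [hexagonMap]
      rw [m2 hi.1 hi.2, mul_zero]
  · simp only [hexagonMap, Prod.mk_eq_zero] at h
    obtain ⟨hz, hy, hw⟩ := h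
    have hp := min_pos_of_rootCombination_eq_zero hx hz
    rcases zmod_six_cases i with rfl | rfl | rfl | rfl | rfl | rfl
    · rw [m1 (by decide) (by decide), sub_zero] at hy
      rw [show (0 : ZMod 6) + 3 = 3 from rfl] at hp
      exact hp.ne' hy
    · rw [m0 (by decide) (by decide), zero_sub, neg_eq_zero] at hy
      rw [show (1 : ZMod 6) + 3 = 4 from rfl] at hp
      exact hp.ne' hy
    · rw [show (2 : ZMod 6) + 3 = 5 from rfl] at hp
      exact hp.ne' hw
    · rw [m1 (by decide) (by decide), sub_zero] at hy
      rw [show (3 : ZMod 6) + 3 = 0 from rfl, min_comm] at hp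
      exact hp.ne' hy
    · rw [m0 (by decide) (by decide), zero_sub, neg_eq_zero] at hy
      rw [show (4 : ZMod 6) + 3 = 1 from rfl, min_comm] at hp
      exact hp.ne' hy
    · rw [show (5 : ZMod 6) + 3 = 2 from rfl, min_comm] at hp
      exact hp.ne' hw

/-- For the hexagon, `rootCombination` vanishes at the midpoints of the three edges between antipodal
vertices; the tripod coordinate keeps these midpoints apart. -/
theorem nonempty_windowComplex_six_homotopyEquiv_puncturedTripod :
    Nonempty (windowComplex 6 ≃ₕ puncturedTripod) := by
  have hW : ∀ x ∈ windowComplex 6, ∃ i, x ∈ windowSimplex i := fun x hx => Set.mem_iUnion.mp hx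
  refine nonempty_homotopyEquiv_of_segment_subset
    ⟨fun x => ⟨hexagonMap x.1, by
      obtain ⟨i, hi⟩ := hW _ x.2
      exact hexagonMap_mem_puncturedTripod hi⟩, by
      have hmin : ∀ j k : ZMod 6, Continuous fun x : windowComplex 6 => min (x.1 j) (x.1 k) :=
        fun j k => ((continuous_apply j).comp continuous_subtype_val).min
          ((continuous_apply k).comp continuous_subtype_val)
      refine Continuous.subtype_mk ?_ _
      exact Continuous.prodMk (by fun_prop)
        (Continuous.prodMk ((hmin 0 3).sub (hmin 1 4)) (hmin 2 5))⟩
    ⟨fun q => ⟨hexagonWeights q.1, hexagonWeights_mem_windowComplex q.2⟩, by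
      refine Continuous.subtype_mk ?_ _
      exact Continuous.smul (Continuous.inv₀ (by fun_prop)
        fun q => (sum_tent_add_legWeight_pos q.2).ne') (by fun_prop)⟩ ?_ ?_
  · intro x
    obtain ⟨i, hi⟩ := hW _ x.2
    exact segment_subset_windowComplex
      (hexagonWeights_mem_windowSimplex (hexagonMap_mem_puncturedTripod hi)
        (fun j hj => val_le_of_tent_rootCombination_ne_zero le_rfl hi hj)
        fun j hj => hi.2.2 j (apply_ne_zero_of_legWeight_hexagonMap hi.1 hj)) hi
  · rintro ⟨q, hq⟩ _ ⟨a, b, ha, hb, hab, rfl⟩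
    have hS := inv_pos.mpr (sum_tent_add_legWeight_pos hq)
    simp only [ContinuousMap.coe_mk, hexagonMap_hexagonWeights hq]
    set l := (∑ j, (tent j q.1 + legWeight q j))⁻¹
    have hc : 0 < a * l + b := by
      rcases ha.eq_or_lt with h | h
      · rw [← h] at hab ⊢; simp at hab ⊢; linarith
      · positivity
    have e2 : ∀ r : ℝ, a * (l * r) + b * r = (a * l + b) * r := fun r => by ring
    refine ⟨?_, ?_, fun h0 => ?_⟩
    · simp only [Prod.snd_add, Prod.smul_snd, smul_eq_mul, e2]
      exact mul_nonneg hc.le hq.1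
    · simp only [Prod.snd_add, Prod.smul_snd, Prod.fst_add, Prod.smul_fst, smul_eq_mul, e2]
      rw [mul_mul_mul_comm, hq.2.1, mul_zero]
    · have hz0 := congrArg (fun p : ℂ × ℝ × ℝ => p.1) h0
      have hy0 := congrArg (fun p : ℂ × ℝ × ℝ => p.2.1) h0
      have hw0 := congrArg (fun p : ℂ × ℝ × ℝ => p.2.2) h0
      simp only [Prod.snd_add, Prod.smul_snd, Prod.fst_add, Prod.smul_fst, smul_eq_mul, e2,
        Prod.fst_zero, Prod.snd_zero] at hz0 hy0 hw0
      have hz : q.1 ≠ 0 := fun hz => hq.2.2 (Prod.ext hz (Prod.ext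
        ((mul_eq_zero.mp hy0).resolve_left hc.ne') ((mul_eq_zero.mp hw0).resolve_left hc.ne')))
      have h1 := re_sum_tent_mul_conj_pos (m := 6) (by norm_num) hz
      have h2 : 0 < (q.1 * (starRingEnd ℂ) q.1).re := by
        rw [Complex.mul_conj, Complex.ofReal_re]
        exact Complex.normSq_pos.mpr hz
      have h3 := congrArg (fun w => (w * (starRingEnd ℂ) q.1).re) hz0
      simp only [add_mul, Complex.add_re, zero_mul, Complex.zero_re, Complex.real_smul, mul_assoc,
        Complex.re_ofReal_mul] at h3
      have h4 := mul_pos hS h1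
      rcases ha.eq_or_lt with h | h
      · rw [← h] at hab h3
        rw [zero_add] at hab
        rw [hab] at h3
        linarith
      · have := mul_pos h h4
        have := mul_nonneg hb h2.le
        linarith

/-! ### Five vertices: the 3-sphere -/

/-- The corner simplex in `ℝ⁴`, with vertices the origin and the standard basis vectors. -/
def cornerSimplex : Set (EuclideanSpace ℝ (Fin (3 + 1))) :=
  {v | (∀ i, 0 ≤ v i) ∧ ∑ i, v i ≤ 1}

theorem convex_cornerSimplex : Convex ℝ cornerSimplex := by
  rintro x ⟨hx0, hx1⟩ y ⟨hy0, hy1⟩ a b ha hb hab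
  refine ⟨fun j => add_nonneg (mul_nonneg ha (hx0 j)) (mul_nonneg hb (hy0 j)), ?_⟩
  simp only [PiLp.add_apply, PiLp.smul_apply, smul_eq_mul, Finset.sum_add_distrib,
    ← Finset.mul_sum]
  nlinarith

theorem isBounded_cornerSimplex : Bornology.IsBounded cornerSimplex := by
  refine isBounded_iff_forall_norm_le.mpr ⟨1, fun v ⟨h0, h1⟩ => ?_⟩
  rw [EuclideanSpace.norm_eq, Real.sqrt_le_iff, one_pow]
  refine ⟨zero_le_one, ?_⟩
  refine le_trans (Finset.sum_le_sum fun i _ => ?_) h1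
  have : v i ≤ 1 := (Finset.single_le_sum (fun j _ => h0 j) (Finset.mem_univ i)).trans h1
  rw [Real.norm_of_nonneg (h0 i)]
  nlinarith [h0 i]

theorem isClosed_cornerSimplex : IsClosed cornerSimplex := by
  have h : cornerSimplex = (⋂ i, {v | 0 ≤ v i}) ∩ {v | ∑ i, v i ≤ 1} := by
    ext v; simp [cornerSimplex]
  rw [h]
  exact (isClosed_iInter fun i => isClosed_le (by fun_prop) (by fun_prop)).inter
    (isClosed_le (by fun_prop) (by fun_prop))

theorem mem_interior_cornerSimplex {v : EuclideanSpace ℝ (Fin (3 + 1))} :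
    v ∈ interior cornerSimplex ↔ (∀ i, 0 < v i) ∧ ∑ i, v i < 1 := by
  constructor
  · intro hv
    -- the facets are cut out by open maps to the line
    have key : ∀ L : EuclideanSpace ℝ (Fin (3 + 1)) →L[ℝ] ℝ, Function.Surjective L →
        ∀ t : Set ℝ, (∀ w ∈ cornerSimplex, L w ∈ t) → L v ∈ interior t := by
      intro L hL t ht
      exact interior_mono (Set.image_subset_iff.mpr ht)
        ((L.isOpenMap hL).image_interior_subset _ ⟨v, hv, rfl⟩)
    constructor
    · intro i
      have := key (EuclideanSpace.proj i)
        (fun r => ⟨EuclideanSpace.single i r, by simp⟩) (Set.Ici 0) fun w hw => hw.1 i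
      rwa [interior_Ici] at this
    · have := key (∑ i, EuclideanSpace.proj i)
        (fun r => ⟨EuclideanSpace.single 0 r, by simp⟩) (Set.Iic 1) fun w hw => by
          simpa using hw.2
      rw [interior_Iic] at this
      simpa using this
  · rintro ⟨h0, h1⟩
    have h : IsOpen ((⋂ i, {v : EuclideanSpace ℝ (Fin (3 + 1)) | 0 < v i}) ∩
        {v | ∑ i, v i < 1}) :=
      (isOpen_iInter_of_finite fun i => isOpen_lt (by fun_prop) (by fun_prop)).inter
        (isOpen_lt (by fun_prop) (by fun_prop))
    refine interior_maximal ?_ h ⟨Set.mem_iInter.mpr h0, h1⟩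
    rintro w ⟨hw0, hw1⟩
    exact ⟨fun i => le_of_lt (Set.mem_iInter.mp hw0 i), le_of_lt hw1⟩

theorem mem_windowComplex_five {x : ZMod 5 → ℝ} :
    x ∈ windowComplex 5 ↔ (∀ j, 0 ≤ x j) ∧ ∑ j, x j = 1 ∧ ∃ j, x j = 0 := by
  constructor
  · rintro hx
    obtain ⟨i, h0, h1, hs⟩ := Set.mem_iUnion.mp hx
    refine ⟨h0, h1, i + 4, ?_⟩
    by_contra h
    have := hs _ h
    rw [add_sub_cancel_left] at this
    exact absurd this (by decide)
  · rintro ⟨h0, h1, j, hj⟩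
    refine Set.mem_iUnion.mpr ⟨j + 1, h0, h1, fun k hk => ?_⟩
    have : k ≠ j := by rintro rfl; exact hk hj
    clear hj hk
    revert k j; decide

/-- For `m = 5`, a window is the complement of one vertex, so the complex is the boundary of the
4-simplex, which is the frontier of a convex body in `ℝ⁴`. -/
theorem nonempty_windowComplex_five_homeomorph_sphere : Nonempty (windowComplex 5 ≃ₜ Sph 3) := by
  have hne : (interior cornerSimplex).Nonempty := by
    refine ⟨WithLp.toLp 2 fun _ => 1 / 5, mem_interior_cornerSimplex.mpr ⟨fun i => ?_, ?_⟩⟩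
    · norm_num
    · norm_num
  obtain ⟨h, -, -, hh⟩ := exists_homeomorph_image_interior_closure_frontier_eq_unitBall
    convex_cornerSimplex hne isBounded_cornerSimplex
  have e₁ : frontier cornerSimplex ≃ₜ Sph 3 := (h.image _).trans (Homeomorph.setCongr hh)
  have hsum : ∀ f : ZMod 5 → ℝ, ∑ j, f j = f 0 + f 1 + f 2 + f 3 + f 4 := fun f =>
    Fin.sum_univ_five f
  have hall : ∀ p : ZMod 5 → Prop, (∀ j, p j) ↔ p 0 ∧ p 1 ∧ p 2 ∧ p 3 ∧ p 4 := by
    intro p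
    refine ⟨fun h => ⟨h _, h _, h _, h _, h _⟩, fun ⟨h0, h1, h2, h3, h4⟩ j => ?_⟩
    have : j = 0 ∨ j = 1 ∨ j = 2 ∨ j = 3 ∨ j = 4 := by revert j; decide
    rcases this with rfl | rfl | rfl | rfl | rfl <;> assumption
  let F : (ZMod 5 → ℝ) → EuclideanSpace ℝ (Fin (3 + 1)) := fun x => !₂[x 0, x 1, x 2, x 3]
  let G : EuclideanSpace ℝ (Fin (3 + 1)) → ZMod 5 → ℝ := fun v =>
    (![v 0, v 1, v 2, v 3, 1 - ∑ i, v i] : Fin 5 → ℝ)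
  have G0 : ∀ v, G v 0 = v 0 := fun v => rfl
  have G1 : ∀ v, G v 1 = v 1 := fun v => rfl
  have G2 : ∀ v, G v 2 = v 2 := fun v => rfl
  have G3 : ∀ v, G v 3 = v 3 := fun v => rfl
  have G4 : ∀ v, G v 4 = 1 - ∑ i, v i := fun v => rfl
  have hfr : ∀ v, v ∈ frontier cornerSimplex ↔ G v ∈ windowComplex 5 := by
    intro v
    have hex : (∃ j, G v j = 0) ↔ ¬ ((∀ i, v i ≠ 0) ∧ ∑ i, v i ≠ 1) := by
      rw [← not_forall_not, not_iff_not, hall, Fin.forall_fin_succ, Fin.forall_fin_succ,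
        Fin.forall_fin_succ, Fin.forall_fin_succ]
      rw [G0, G1, G2, G3, G4, sub_eq_zero, eq_comm (a := (1 : ℝ))]
      simp only [IsEmpty.forall_iff, and_true, and_assoc, ne_eq]
      rfl
    rw [isClosed_cornerSimplex.frontier_eq, Set.mem_sdiff, mem_interior_cornerSimplex,
      mem_windowComplex_five, hex, hall, hsum, G0, G1, G2, G3, G4]
    constructor
    · rintro ⟨⟨h0, h1⟩, h2⟩
      refine ⟨⟨h0 _, h0 _, h0 _, h0 _, by linarith⟩, ?_, fun ⟨h3, h4⟩ =>
        h2 ⟨fun i => lt_of_le_of_ne (h0 i) (h3 i).symm, lt_of_le_of_ne h1 h4⟩⟩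
      rw [Fin.sum_univ_four]; ring
    · rintro ⟨⟨h0, h1, h2, h3, h4⟩, -, h5⟩
      refine ⟨⟨fun i => ?_, by linarith⟩, fun ⟨h6, h7⟩ => h5 ⟨fun i => (h6 i).ne', h7.ne⟩⟩
      fin_cases i <;> assumption
  have hGF : ∀ x ∈ windowComplex 5, G (F x) = x := by
    intro x hx
    have h1 := (mem_windowComplex_five.mp hx).2.1
    rw [hsum] at h1
    refine funext ((hall _).mpr ⟨rfl, rfl, rfl, rfl, ?_⟩)
    rw [G4, Fin.sum_univ_four]
    simp [F]
    linarith
  have hFG : ∀ v, F (G v) = v := by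
    intro v
    ext i
    fin_cases i <;> rfl
  have hFc : Continuous F := by
    refine (PiLp.continuous_toLp 2 _).comp (continuous_pi fun i => ?_)
    fin_cases i <;> exact continuous_apply (A := fun _ : ZMod 5 => ℝ) _
  have hGc : Continuous G := by
    refine continuous_pi ((hall _).mpr ⟨?_, ?_, ?_, ?_, ?_⟩)
    · simp only [G0]; fun_prop
    · simp only [G1]; fun_prop
    · simp only [G2]; fun_prop
    · simp only [G3]; fun_prop
    · simp only [G4]; fun_prop
  have e₂ : windowComplex 5 ≃ₜ frontier cornerSimplex :=
    { toFun := fun x => ⟨F x, (hfr _).mpr (by rw [hGF _ x.2]; exact x.2)⟩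
      invFun := fun v => ⟨G v, (hfr _).mp v.2⟩
      left_inv := fun x => Subtype.ext (hGF _ x.2)
      right_inv := fun v => Subtype.ext (hFG _)
      continuous_toFun := by
        refine Continuous.subtype_mk ?_ _
        exact hFc.comp continuous_subtype_val
      continuous_invFun := by
        refine Continuous.subtype_mk ?_ _
        exact hGc.comp continuous_subtype_val }
  exact ⟨e₂.trans e₁⟩

/-! ### Connectedness of the window complex -/

theorem preconnectedSpace_windowComplex {m : ℕ} [NeZero m] : PreconnectedSpace (windowComplex m) := by
  have hU : windowComplex m = ⋃ k : ℕ, windowSimplex (k : ZMod m) := by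
    refine Set.Subset.antisymm (Set.iUnion_subset fun i => ?_) (Set.iUnion_subset fun k =>
      Set.subset_iUnion (windowSimplex (m := m)) k)
    rw [← ZMod.natCast_zmod_val i]
    exact Set.subset_iUnion (fun k : ℕ => windowSimplex (k : ZMod m)) i.val
  refine isPreconnected_iff_preconnectedSpace.mp ?_
  rw [hU]
  refine IsPreconnected.iUnion_of_chain
    (fun k : ℕ => (convex_windowSimplex (k : ZMod m)).isPreconnected) fun k => ?_
  have hmem : ∀ i j : ZMod m, (j - i).val ≤ 3 → Pi.single j (1 : ℝ) ∈ windowSimplex i := by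
    intro i j hij
    refine ⟨fun l => ?_, by simp, fun l hl => ?_⟩
    · by_cases h : l = j
      · subst h; simp
      · simp [h]
    · by_cases h : l = j
      · rwa [h]
      · simp [h] at hl
  refine ⟨Pi.single ((k + 1 : ℕ) : ZMod m) 1, hmem _ _ ?_, hmem _ _ ?_⟩
  · rw [Nat.cast_add, add_sub_cancel_left, ZMod.val_natCast]
    exact (Nat.mod_le _ _).trans (by norm_num)
  · simp

/-! ### The components of the neighborhood complex -/

/-- The face that carries a point can be taken to be the support of the point. -/
theorem mem_geomRealization_neighborhoodComplex {V : Type*} [Fintype V] {G : SimpleGraph V}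
    {x : V → ℝ} : x ∈ geomRealization (neighborhoodComplex G) ↔
      (∀ v, 0 ≤ x v) ∧ ∑ v, x v = 1 ∧ ∃ w, ∀ v, x v ≠ 0 → G.Adj v w := by
  classical
  constructor
  · rintro ⟨σ, ⟨-, w, hw⟩, h0, hs, h1⟩
    refine ⟨h0, ?_, w, fun v hv => hw v (by_contra fun h => hv (hs v h))⟩
    rw [← h1]
    exact (Finset.sum_subset (Finset.subset_univ σ) fun v _ hv => hs v hv).symm
  · rintro ⟨h0, h1, w, hw⟩
    have hsum : ∑ v with x v ≠ 0, x v = 1 := by rw [Finset.sum_filter_ne_zero, h1]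
    refine ⟨Finset.univ.filter fun v => x v ≠ 0, ⟨?_, w, fun v hv => hw v (by simpa using hv)⟩,
      h0, fun v hv => by simpa using hv, hsum⟩
    by_contra h
    rw [Finset.not_nonempty_iff_eq_empty.mp h, Finset.sum_empty] at hsum
    exact zero_ne_one hsum

theorem circulant_adj_iff {n s : ℕ} (hs : (s : ZMod n) ≠ 0) (hs3 : (3 * s : ZMod n) ≠ 0)
    {v w : ZMod n} : (circulant n s (3 * s)).Adj v w ↔
      ∃ k : ℕ, k ≤ 3 ∧ v = w - 3 * s + k • (2 * s : ZMod n) := by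
  simp only [circulant, SimpleGraph.circulantGraph_adj, Set.mem_insert_iff, Set.mem_singleton_iff]
  push_cast
  constructor
  · rintro ⟨-, (h | h) | (h | h)⟩
    · exact ⟨2, by norm_num, by rw [nsmul_eq_mul]; push_cast; linear_combination h⟩
    · exact ⟨3, by norm_num, by rw [nsmul_eq_mul]; push_cast; linear_combination h⟩
    · exact ⟨1, by norm_num, by rw [nsmul_eq_mul]; push_cast; linear_combination -h⟩
    · exact ⟨0, by norm_num, by rw [nsmul_eq_mul]; push_cast; linear_combination -h⟩
  · rintro ⟨k, hk, h⟩
    rw [nsmul_eq_mul] at h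
    interval_cases k <;> push_cast at h
    · exact ⟨fun e => hs3 (by linear_combination h - e), Or.inr (Or.inr (by linear_combination -h))⟩
    · exact ⟨fun e => hs (by linear_combination h - e), Or.inr (Or.inl (by linear_combination -h))⟩
    · exact ⟨fun e => hs (by linear_combination e - h), Or.inl (Or.inl (by linear_combination h))⟩
    · exact ⟨fun e => hs3 (by linear_combination e - h), Or.inl (Or.inr (by linear_combination h))⟩

/-- If the neighborhoods in `G` are the sets `w - b + {0, a, 2a, 3a}`, then the components of the
neighborhood complex are the parts on the cosets of the subgroup generated by `a`. Along the
bijection of this subgroup with `ZMod m`, the neighborhoods are the windows of length four. -/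
theorem nonempty_connectedComponent_homeomorph_windowComplex {n m : ℕ} [NeZero n] [NeZero m]
    (hm : 4 ≤ m) {G : SimpleGraph (ZMod n)} {a b : ZMod n} (hma : addOrderOf a = m)
    (hG : ∀ v w, G.Adj v w ↔ ∃ k : ℕ, k ≤ 3 ∧ v = w - b + k • a)
    (x : geomRealization (neighborhoodComplex G)) :
    Nonempty (connectedComponent x ≃ₜ windowComplex m) := by
  obtain ⟨φ, hφ, hφi⟩ : ∃ φ : ZMod m →+ ZMod n, (∀ k : ℕ, φ k = k • a) ∧ Function.Injective φ := by
    refine ⟨ZMod.lift m ⟨zmultiplesHom _ a, ?_⟩, fun k => ?_, ?_⟩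
    · rw [zmultiplesHom_apply, natCast_zsmul, ← hma, addOrderOf_nsmul_eq_zero]
    · have := ZMod.lift_coe m ⟨zmultiplesHom _ a, by
        rw [zmultiplesHom_apply, natCast_zsmul, ← hma, addOrderOf_nsmul_eq_zero]⟩ (k : ℤ)
      rw [Int.cast_natCast] at this
      rw [this, zmultiplesHom_apply, natCast_zsmul]
    · rw [ZMod.lift_injective]
      intro k hk
      rw [zmultiplesHom_apply] at hk
      rw [ZMod.intCast_zmod_eq_zero_iff_dvd, ← hma]
      exact addOrderOf_dvd_iff_zsmul_eq_zero.mpr hk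
  obtain ⟨w₀, hw₀⟩ := (mem_geomRealization_neighborhoodComplex.mp x.2).2.2
  set c := w₀ - b with hc
  let e : ZMod m → ZMod n := fun j => c + φ j
  have he : Function.Injective e := fun i j h => hφi (add_left_cancel h)
  let T : Set (geomRealization (neighborhoodComplex G)) := {y | ∀ v, y.1 v ≠ 0 → v ∈ Set.range e}
  -- all vertices of a simplex lie in the same coset
  have hT : ∀ y : geomRealization (neighborhoodComplex G), ∀ v ∈ Set.range e, y.1 v ≠ 0 →
      ∃ i : ZMod m, ∀ v', y.1 v' ≠ 0 → ∃ k : ℕ, k ≤ 3 ∧ v' = e (i + k) := by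
    rintro y _ ⟨j, rfl⟩ hj
    obtain ⟨w, hw⟩ := (mem_geomRealization_neighborhoodComplex.mp y.2).2.2
    obtain ⟨k, -, hk⟩ := (hG _ _).mp (hw _ hj)
    refine ⟨j - k, fun v' hv' => ?_⟩
    obtain ⟨k', hk', h'⟩ := (hG _ _).mp (hw _ hv')
    refine ⟨k', hk', ?_⟩
    simp only [e] at hk ⊢
    rw [map_add, map_sub, hφ, hφ, h', ← add_assoc, ← add_sub_assoc, hk, add_sub_cancel_right]
  have hne : ∀ y : geomRealization (neighborhoodComplex G), ∃ v, y.1 v ≠ 0 := by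
    intro y
    by_contra! h
    have := (mem_geomRealization_neighborhoodComplex.mp y.2).2.1
    simp [h] at this
  have hclopen : IsClopen T := by
    constructor
    · have : T = ⋂ v ∈ (Set.range e)ᶜ, {y | y.1 v = 0} := by
        ext y
        simp only [T, Set.mem_ofPred_eq, Set.mem_iInter, Set.mem_compl_iff]
        exact forall_congr' fun v => not_imp_comm
      rw [this]
      exact isClosed_biInter fun v _ => isClosed_eq
        ((continuous_apply v).comp continuous_subtype_val) continuous_const
    · have : T = ⋃ v ∈ Set.range e, {y | y.1 v ≠ 0} := by
        ext y
        simp only [T, Set.mem_ofPred_eq, Set.mem_iUnion, exists_prop]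
        constructor
        · intro h
          obtain ⟨v, hv⟩ := hne y
          exact ⟨v, h v hv, hv⟩
        · rintro ⟨v, hv, hv0⟩ v' hv'
          obtain ⟨i, hi⟩ := hT y v hv hv0
          obtain ⟨k, -, hk⟩ := hi v' hv'
          exact ⟨_, hk.symm⟩
      rw [this]
      exact isOpen_biUnion fun v _ => isOpen_ne_fun
        ((continuous_apply v).comp continuous_subtype_val) continuous_const
  have hxT : x ∈ T := by
    intro v hv
    obtain ⟨k, -, hk⟩ := (hG _ _).mp (hw₀ v hv)
    exact ⟨k, by simp only [e]; rw [hφ, hk]⟩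
  let E : windowComplex m → ZMod n → ℝ := fun y => Function.extend e y.1 0
  have hE : ∀ y j, E y (e j) = y.1 j := fun y j => he.extend_apply _ _ _
  have hE' : ∀ y v, v ∉ Set.range e → E y v = 0 := fun y v hv =>
    Function.extend_apply' _ _ _ hv
  have hEc : Continuous E := by
    refine continuous_pi fun v => ?_
    by_cases hv : v ∈ Set.range e
    · obtain ⟨j, rfl⟩ := hv
      simp only [hE]
      exact (continuous_apply j).comp continuous_subtype_val
    · simp only [hE' _ v hv]
      exact continuous_const
  have hEmem : ∀ y, E y ∈ geomRealization (neighborhoodComplex G) := by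
    intro y
    obtain ⟨i, h0, h1, hs⟩ := Set.mem_iUnion.mp y.2
    refine mem_geomRealization_neighborhoodComplex.mpr ⟨fun v => ?_, ?_, e i + b, fun v hv => ?_⟩
    · by_cases hv : v ∈ Set.range e
      · obtain ⟨j, rfl⟩ := hv
        rw [hE]; exact h0 j
      · rw [hE' y v hv]
    · rw [← h1]
      exact (Fintype.sum_of_injective e he y.1 (E y) (hE' y) fun j => (hE y j).symm).symm
    · by_cases hvr : v ∈ Set.range e
      · obtain ⟨j, rfl⟩ := hvr
        rw [hE] at hv
        refine (hG _ _).mpr ⟨_, hs j hv, ?_⟩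
        simp only [e]
        rw [← hφ, ZMod.natCast_zmod_val, map_sub]
        abel
      · exact absurd (hE' y v hvr) hv
  have hET : ∀ y, (⟨E y, hEmem y⟩ : geomRealization (neighborhoodComplex G)) ∈ T :=
    fun y v hv => by_contra fun h => hv (hE' y v h)
  have hR : ∀ y ∈ T, (fun j => y.1 (e j)) ∈ windowComplex m := by
    intro y hy
    obtain ⟨h0, h1, -⟩ := mem_geomRealization_neighborhoodComplex.mp y.2
    obtain ⟨v, hv⟩ := hne y
    obtain ⟨i, hi⟩ := hT y v (hy v hv) hv
    refine Set.mem_iUnion.mpr ⟨i, fun j => h0 _, ?_, fun j hj => ?_⟩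
    · rw [← h1]
      exact Fintype.sum_of_injective e he _ y.1 (fun v hv => by_contra fun h => hv (hy v h))
        fun j => rfl
    · obtain ⟨k, hk, hjk⟩ := hi _ hj
      rw [he hjk, add_sub_cancel_left, ZMod.val_natCast_of_lt (by omega)]
      exact hk
  have hRE : ∀ y ∈ T, ∀ h, E ⟨fun j => y.1 (e j), h⟩ = y.1 := by
    intro y hy h
    funext v
    by_cases hv : v ∈ Set.range e
    · obtain ⟨j, rfl⟩ := hv
      rw [hE]
    · rw [hE' _ v hv]
      exact (by_contra fun h => hv (hy v (Ne.symm h)))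
  let Φ : T ≃ₜ windowComplex m :=
    { toFun := fun y => ⟨fun j => y.1.1 (e j), hR y.1 y.2⟩
      invFun := fun y => ⟨⟨E y, hEmem y⟩, hET y⟩
      left_inv := fun y => Subtype.ext (Subtype.ext (hRE y.1 y.2 _))
      right_inv := fun y => Subtype.ext (funext fun j => hE y j)
      continuous_toFun := by
        refine Continuous.subtype_mk (continuous_pi fun j => ?_) _
        exact (continuous_apply (e j)).comp (continuous_subtype_val.comp continuous_subtype_val)
      continuous_invFun := (hEc.subtype_mk _).subtype_mk _ }
  have hTconn : IsPreconnected T := by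
    have := preconnectedSpace_windowComplex (m := m)
    have hrange : Set.range (fun y => ((Φ.symm y : T) : geomRealization (neighborhoodComplex G)))
        = T := by
      rw [Set.range_comp' Subtype.val Φ.symm, Φ.symm.surjective.range_eq, Set.image_univ,
        Subtype.range_coe]
    rw [← hrange]
    exact isPreconnected_range (continuous_subtype_val.comp Φ.symm.continuous)
  have hcc : connectedComponent x = T :=
    Set.Subset.antisymm (hclopen.connectedComponent_subset hxT)
      (hTconn.subset_connectedComponent hxT)
  exact ⟨(Homeomorph.setCongr hcc).trans Φ⟩

theorem circulant_comm (n s t : ℕ) : circulant n s t = circulant n t s := by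
  rw [circulant, circulant, Set.pair_comm]

/-- The components of the neighborhood complex of `C_n(s, 3s)` are window complexes on `ZMod m`,
where `m` is the order of `2s` modulo `n`. -/
theorem exists_windowComplex_homeomorph {n s : ℕ} (hs : 1 ≤ s) (h6 : 6 * s < n) (h8 : n ≠ 8 * s) :
    ∃ (m : ℕ) (_ : NeZero m), 5 ≤ m ∧ (m = 5 ↔ n = 10 * s) ∧ (m = 6 ↔ n = 12 * s) ∧
      ∀ x : geomRealization (neighborhoodComplex (circulant n s (3 * s))),
        Nonempty (connectedComponent x ≃ₜ windowComplex m) := by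
  have : NeZero n := ⟨by omega⟩
  have hcast : ∀ k : ℕ, 0 < k → k < n → (k : ZMod n) ≠ 0 := fun k hk hkn h =>
    absurd (Nat.le_of_dvd hk ((ZMod.natCast_eq_zero_iff k n).mp h)) (by omega)
  have hiff : ∀ k : ℕ, k • (2 * s : ZMod n) = 0 ↔ n ∣ k * (2 * s) := by
    intro k
    rw [← ZMod.natCast_eq_zero_iff, nsmul_eq_mul]
    push_cast
    rfl
  set m := addOrderOf (2 * s : ZMod n) with hm
  have hm0 : 0 < m := addOrderOf_pos _
  have : NeZero m := ⟨hm0.ne'⟩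
  obtain ⟨q, hq⟩ := (hiff m).mp (addOrderOf_nsmul_eq_zero _)
  -- a multiple of `n` that is at most `12 s` is `n` itself, because `12 s < 2 n`
  have hq1 : m ≤ 6 → q = 1 := by
    intro hle
    have h1 : m * (2 * s) ≤ 6 * (2 * s) := Nat.mul_le_mul_right _ hle
    have h2 : 0 < m * (2 * s) := by positivity
    have h3 : 0 < q := Nat.pos_of_ne_zero fun h => by rw [h] at hq; omega
    by_contra h
    have h4 : n * 2 ≤ n * q := Nat.mul_le_mul_left _ (by omega)
    omega
  have hm5 : 5 ≤ m := by
    by_contra! h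
    rw [hq1 (by omega), mul_one] at hq
    have : m = 1 ∨ m = 2 ∨ m = 3 ∨ m = 4 := by omega
    rcases this with h | h | h | h <;> rw [h] at hq <;> omega
  refine ⟨m, this, hm5, ⟨fun h => ?_, fun h => ?_⟩, ⟨fun h => ?_, fun h => ?_⟩, fun x =>
    nonempty_connectedComponent_homeomorph_windowComplex (by omega) hm.symm (b := (3 * s : ZMod n))
      (fun v w => circulant_adj_iff (hcast s (by omega) (by omega)) ?_) x⟩
  · rw [hq1 (by omega), h] at hq; omega
  · have := Nat.le_of_dvd (by norm_num)
      (addOrderOf_dvd_of_nsmul_eq_zero ((hiff 5).mpr ⟨1, by rw [h]; ring⟩))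
    omega
  · rw [hq1 (by omega), h] at hq; omega
  · have hd := addOrderOf_dvd_of_nsmul_eq_zero ((hiff 6).mpr ⟨1, by rw [h]; ring⟩)
    have := Nat.le_of_dvd (by norm_num) hd
    by_contra hne
    have : m = 5 := by omega
    rw [← hm, this] at hd
    omega
  · have := hcast (3 * s) (by omega) (by omega)
    push_cast at this
    exact this

theorem neighborhoodComplex_circulant_three_mul {n s : ℕ} (hs : 1 ≤ s) (h6 : 6 * s < n)
    (h8 : n ≠ 8 * s) (x : geomRealization (neighborhoodComplex (circulant n s (3 * s)))) :
    (n = 10 * s → Nonempty (connectedComponent x ≃ₕ Sph 3)) ∧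
    (n = 12 * s → Nonempty (connectedComponent x ≃ₕ SphWedge 2 2)) ∧
    (n ≠ 10 * s → n ≠ 12 * s → Nonempty (connectedComponent x ≃ₕ SphWedge 1 1)) := by
  obtain ⟨m, hm, h5, hm5, hm6, hx⟩ := exists_windowComplex_homeomorph hs h6 h8
  obtain ⟨e⟩ := hx x
  refine ⟨fun h => ?_, fun h => ?_, fun h10 h12 => ?_⟩
  · obtain rfl := hm5.mpr h
    obtain ⟨e'⟩ := nonempty_windowComplex_five_homeomorph_sphere
    exact ⟨(e.trans e').toHomotopyEquiv⟩
  · obtain rfl := hm6.mpr h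
    obtain ⟨e₁⟩ := nonempty_windowComplex_six_homotopyEquiv_puncturedTripod
    obtain ⟨e₂⟩ := nonempty_puncturedTripod_homotopyEquiv_sphWedge
    exact ⟨e.toHomotopyEquiv.trans (e₁.trans e₂)⟩
  · have : m ≠ 5 := fun h => h10 (hm5.mp h)
    have : m ≠ 6 := fun h => h12 (hm6.mp h)
    obtain ⟨e₁⟩ := nonempty_windowComplex_homotopyEquiv_compl_zero (m := m) (by omega)
    obtain ⟨e₂⟩ := nonempty_compl_zero_homotopyEquiv_sphWedge
    exact ⟨e.toHomotopyEquiv.trans (e₁.trans e₂)⟩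

theorem theorem3p4 (n s t : ℕ) (hn : 5 ≤ n) (hst : InI2 n s t) :
    (((3 * s = t ∧ n = 10 * s) ∨ (3 * t = s ∧ n = 10 * t)) →
      ∀ x : geomRealization (neighborhoodComplex (circulant n s t)),
        Nonempty (connectedComponent x ≃ₕ Sph 3)) ∧
    (((3 * s = t ∧ n = 12 * s) ∨ (3 * t = s ∧ n = 12 * t)) →
      ∀ x : geomRealization (neighborhoodComplex (circulant n s t)),
        Nonempty (connectedComponent x ≃ₕ SphWedge 2 2)) ∧
    (((3 * s = t ∧ n ≠ 8 * s ∧ n ≠ 10 * s ∧ n ≠ 12 * s) ∨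
        (3 * t = s ∧ n ≠ 8 * t ∧ n ≠ 10 * t ∧ n ≠ 12 * t)) →
      ∀ x : geomRealization (neighborhoodComplex (circulant n s t)),
        ∃ k : ℕ, 1 ≤ k ∧ Nonempty (connectedComponent x ≃ₕ SphWedge k 1)) := by
  obtain ⟨⟨⟨hs1, hs2⟩, ⟨ht1, ht2⟩, hne⟩, hI1, h3⟩ := hst
  have hI : ¬(n = 2 * s ∨ n = 2 * t ∨ n = 2 * (s + t)) := fun h =>
    hI1 ⟨⟨⟨hs1, hs2⟩, ⟨ht1, ht2⟩, hne⟩, h⟩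
  rcases h3 with rfl | rfl
  · have key := neighborhoodComplex_circulant_three_mul (n := n) hs1 (by omega) (by omega)
    exact ⟨fun h x => (key x).1 (by omega), fun h x => (key x).2.1 (by omega),
      fun h x => ⟨1, le_rfl, (key x).2.2 (by omega) (by omega)⟩⟩
  · rw [circulant_comm]
    have key := neighborhoodComplex_circulant_three_mul (n := n) ht1 (by omega) (by omega)
    exact ⟨fun h x => (key x).1 (by omega), fun h x => (key x).2.1 (by omega),
      fun h x => ⟨1, le_rfl, (key x).2.2 (by omega) (by omega)⟩⟩
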